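/- Let $H$ be a finite-dimensional Hopf algebra over a field $\mathbb{k}$ with coproduct $\Delta$, counit $\epsilon$ and antipode $S$. Assume that $H$ is unimodular, i.e. every $c\in H$ with $cx=\epsilon(x)c$ for all $x\in H$ also satisfies $xc=\epsilon(x)c$ for all $x\in H$. Let $g\in H$ be a pivot, i.e. a group-like element with $S^2(x)=gxg^{-1}$ for all $x\in H$. Finite-dimensional left $H$-modules form a pivotal category: $V^*=\mathrm{Hom}_{\mathbb{k}}(V,\mathbb{k})$ with $(hf)(v)=f(S(h)v)$, and, for a basis $(v_j)$ of $V$ with dual basis $(v_j^*)$, $$\mathrm{ev}_V(f\otimes v)=f(v),\quad \mathrm{coev}_V(1)=\sum_j v_j\otimes v_j^*,\quad \widetilde{\mathrm{ev}}_V(v\otimes f)=f(gv),\quad \widetilde{\mathrm{coev}}_V(1)=\sum_j v_j^*\otimes g^{-1}v_j .$$ Let $H\text{-pmod}$ be the full subcategory of projective modules. A Calabi–Yau structure on $H\text{-pmod}$ is a family of linear forms $t_P:\mathrm{End}_H(P)\to\mathbb{k}$, $P\in H\text{-pmod}$, with $t_V(b\circ a)=t_W(a\circ b)$ for all $a:V\to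 W$, $b:W\to V$, such that all pairings $\mathrm{Hom}_H(V,W)\times\mathrm{Hom}_H(W,V)\to\mathbb{k}$, $(a,b)\mapsto t_W(a\circ b)$, are non-degenerate. It is compatible with duality on the right if for all $U,V,W\in H\text{-pmod}$, $a:U\otimes V\to W$, $b:W\to U\otimes V$, $$t_{U\otimes V}(b\circ a)=t_U\big((\mathrm{id}_U\otimes\widetilde{\mathrm{ev}}_V)\circ(b\otimes\mathrm{id}_{V^*})\circ(a\otimes\mathrm{id}_{V^*})\circ(\mathrm{id}_U\otimes\mathrm{coev}_V)\big),$$ and compatible with duality on the left if for all such $U,V,W,a,b$ $$t_{U\otimes V}(b\circ a)=t_V\big((\mathrm{ev}_U\otimes\mathrm{id}_V)\circ(\mathrm{id}_{U^*}\otimes b)\circ(\mathrm{id}_{U^*}\otimes a)\circ(\widetilde{\mathrm{coev}}_U\otimes\mathrm{id}_V)\big).$$ Then: 1. The Calabi–Yau structures on $H\text{-pmod}$ compatible with duality on the right are exactly the non-zero elements of a 1-dimensional space of families $(t_P)_P$. In particular such a structure exists and is unique up to a non-zero scalar. 2. The same holds for the Calabi–Yau structures on $H\text{-pmod}$ compatible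 with duality on the left. 3. A Calabi–Yau structure compatible with duality on the right is also compatible on the left if and only if $(H,g)$ is unibalanced, and likewise a Calabi–Yau structure compatible on the left is also compatible on the right if and only if $(H,g)$ is unibalanced. Here $(H,g)$ is unibalanced if for every right integral $\mu\in H^*$ (i.e. $(\mu\otimes\mathrm{id})\Delta(x)=\mu(x)1$ for all $x$) there is a left integral $\nu\in H^*$ (i.e. $(\mathrm{id}\otimes\nu)\Delta(x)=\nu(x)1$ for all $x$) with $\mu(gx)=\nu(g^{-1}x)$ for all $x\in H$. -/

import Mathlib

open scoped TensorProduct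

universe u

/-- Right integrals: linear forms `μ` on `H` with `(μ ⊗ id) Δ(x) = μ(x) 1` for all `x`. -/
def IsRightIntegral {k H : Type u} [Field k] [Ring H] [HopfAlgebra k H] (μ : H →ₗ[k] k) : Prop :=
  ∀ x : H, TensorProduct.lid k H (μ.rTensor H (Coalgebra.comul (R := k) x)) = μ x • (1 : H)

/-- Left integrals: linear forms `μ` on `H` with `(id ⊗ μ) Δ(x) = μ(x) 1` for all `x`. -/
def IsLeftIntegral {k H : Type u} [Field k] [Ring H] [HopfAlgebra k H] (μ : H →ₗ[k] k) : Prop :=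
  ∀ x : H, TensorProduct.rid k H (μ.lTensor H (Coalgebra.comul (R := k) x)) = μ x • (1 : H)

/-- `H` is unimodular: its right cointegrals (`c x = ε(x) c` for all `x`) are also
left cointegrals (`x c = ε(x) c` for all `x`). -/
def IsUnimodular (k H : Type u) [Field k] [Ring H] [HopfAlgebra k H] : Prop :=
  ∀ c : H, (∀ x : H, c * x = Coalgebra.counit (R := k) x • c) →
    ∀ x : H, x * c = Coalgebra.counit (R := k) x • c

/-- A pivot of `H`: a group-like element `g` with `S²(x) = g x g⁻¹` for all `x`.
(Group-like elements of a Hopf algebra are units.) -/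
structure Pivot (k H : Type u) [Field k] [Ring H] [HopfAlgebra k H] where
  val : Hˣ
  isGroupLike : IsGroupLikeElem k (val : H)
  antipode_antipode : ∀ x : H,
    HopfAlgebra.antipode k (HopfAlgebra.antipode k x) = (val : H) * x * ((val⁻¹ : Hˣ) : H)

/-- `(H, g)` is unibalanced: the symmetrised right integral `x ↦ μ(g x)` is also a symmetrised
left integral, i.e. of the form `x ↦ ν(g⁻¹ x)` for a left integral `ν`. (Right integrals are unique
up to a scalar, so it does not matter which one is taken.) -/
def IsUnibalanced {k H : Type u} [Field k] [Ring H] [HopfAlgebra k H] (g : Pivot k H) : Prop :=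
  ∀ μ : H →ₗ[k] k, IsRightIntegral μ →
    ∃ ν : H →ₗ[k] k, IsLeftIntegral ν ∧
      ∀ x : H, μ ((g.val : H) * x) = ν (((g.val⁻¹ : Hˣ) : H) * x)

/-- Finite-dimensional left `H`-modules, as finite-dimensional vector spaces with an algebra
homomorphism `ρ` to the endomorphism algebra. -/
structure HopfRep (k H : Type u) [Field k] [Ring H] [HopfAlgebra k H] where
  carrier : Type u
  [addCommGroup : AddCommGroup carrier]
  [module : Module k carrier]
  [finiteDimensional : FiniteDimensional k carrier]
  ρ : H →ₐ[k] Module.End k carrier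

namespace HopfRep

attribute [instance] HopfRep.addCommGroup HopfRep.module HopfRep.finiteDimensional

variable {k H : Type u} [Field k] [Ring H] [HopfAlgebra k H]

instance : CoeSort (HopfRep k H) (Type u) := ⟨HopfRep.carrier⟩

/-- The space of morphisms of `H`-modules. -/
def Hom (V W : HopfRep k H) : Submodule k (V →ₗ[k] W) where
  carrier := {f | ∀ (h : H) (v : V), f (V.ρ h v) = W.ρ h (f v)}
  add_mem' := fun hf hg h v => by simp [hf h v, hg h v]
  zero_mem' := fun h v => by simp
  smul_mem' := fun c f hf h v => by simp [hf h v]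

namespace Hom

def id (V : HopfRep k H) : Hom V V := ⟨LinearMap.id, fun _ _ => rfl⟩

/-- Composition `f ∘ g`. -/
def comp {U V W : HopfRep k H} (f : Hom V W) (g : Hom U V) : Hom U W :=
  ⟨f.1 ∘ₗ g.1, fun h v => by simp [g.2 h v, f.2 h (g.1 v)]⟩

end Hom

/-- The underlying `H`-module, in the sense of Mathlib. -/
def AsModule (V : HopfRep k H) : Type u := V.carrier

instance (V : HopfRep k H) : AddCommGroup V.AsModule := V.addCommGroup

instance (V : HopfRep k H) : Module H V.AsModule :=
  Module.compHom V.carrier V.ρ.toRingHom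

def IsProjective (V : HopfRep k H) : Prop := Module.Projective H V.AsModule

/-- The action of `H ⊗ H` on `V ⊗ W`. -/
noncomputable def act₂ (V W : HopfRep k H) : H ⊗[k] H →ₐ[k] Module.End k (V ⊗[k] W) :=
  Module.endTensorEndAlgHom.comp (Algebra.TensorProduct.map V.ρ W.ρ)

lemma act₂_tmul (V W : HopfRep k H) (x y : H) :
    V.act₂ W (x ⊗ₜ y) = TensorProduct.map (V.ρ x) (W.ρ y) := by
  simp [act₂, Module.endTensorEndAlgHom_apply]
  rfl

/-- The tensor product `V ⊗ W`, on which `H` acts through its coproduct. -/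
noncomputable abbrev tensor (V W : HopfRep k H) : HopfRep k H where
  carrier := V ⊗[k] W
  ρ := (V.act₂ W).comp (Bialgebra.comulAlgHom k H)

lemma tensor_ρ (V W : HopfRep k H) (h : H) :
    (V.tensor W).ρ h = V.act₂ W (Coalgebra.comul (R := k) h) := rfl

/-- The trivial module `k`, on which `H` acts through its counit. -/
noncomputable abbrev unit (k H : Type u) [Field k] [Ring H] [HopfAlgebra k H] : HopfRep k H where
  carrier := k
  ρ := (Algebra.ofId k (Module.End k k)).comp (Bialgebra.counitAlgHom k H)

lemma unit_ρ (h : H) (c : k) :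
    (unit k H).ρ h c = Coalgebra.counit (R := k) h * c := by
  change (Algebra.ofId k (Module.End k k)) (Coalgebra.counit (R := k) h) c = _
  simp [Algebra.ofId_apply, Module.algebraMap_end_apply]

/-- The left dual `V* = Hom_k(V, k)` with the action `(h f)(v) = f(S(h) v)`. -/
noncomputable abbrev dual (V : HopfRep k H) : HopfRep k H where
  carrier := Module.Dual k V
  ρ := AlgHom.ofLinearMap
    ((Module.Dual.transpose (R := k) (M := V) (M' := V)) ∘ₗ
      V.ρ.toLinearMap ∘ₗ HopfAlgebra.antipode k (A := H))
    (by ext; simp; rfl) (fun x y => by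
      ext f v; simp [HopfAlgebra.antipode_mul_antidistrib]; rfl)

lemma dual_ρ (V : HopfRep k H) (h : H) (f : Module.Dual k V) :
    V.dual.ρ h f = f ∘ₗ V.ρ (HopfAlgebra.antipode k h) := rfl

lemma coevaluation_transpose (V : HopfRep k H) (T : V →ₗ[k] V) :
    (Module.Dual.transpose (R := k) T).lTensor V (coevaluation k V 1) =
      T.rTensor (Module.Dual k V) (coevaluation k V 1) := by
  classical
  let b := Module.Basis.ofVectorSpace k V
  simp only [coevaluation_apply_one, map_sum, LinearMap.lTensor_tmul, LinearMap.rTensor_tmul]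
  have h₁ : ∀ i, Module.Dual.transpose (R := k) T (b.coord i) =
      ∑ j, b.repr (T (b j)) i • b.coord j := fun i => by
    rw [← b.sum_dual_apply_smul_coord (Module.Dual.transpose (R := k) T (b.coord i))]
    rfl
  have h₂ : ∀ j, T (b j) = ∑ i, b.repr (T (b j)) i • b i := fun j => (b.sum_repr _).symm
  calc ∑ i, b i ⊗ₜ[k] Module.Dual.transpose (R := k) T (b.coord i)
      = ∑ i, ∑ j, (b.repr (T (b j)) i • b i) ⊗ₜ[k] b.coord j := by
        refine Finset.sum_congr rfl fun i _ => ?_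
        rw [h₁, TensorProduct.tmul_sum]
        simp [TensorProduct.smul_tmul]
    _ = ∑ j, T (b j) ⊗ₜ[k] b.coord j := by
        rw [Finset.sum_comm]
        refine Finset.sum_congr rfl fun j _ => ?_
        rw [← TensorProduct.sum_tmul, ← h₂]

namespace Hom

/-- The tensor product `f ⊗ g` of two morphisms. -/
noncomputable def tensor {V V' W W' : HopfRep k H} (f : Hom V V') (g : Hom W W') :
    Hom (V.tensor W) (V'.tensor W') :=
  ⟨TensorProduct.map f.1 g.1, fun h x => by
    have key : ∀ z : H ⊗[k] H, TensorProduct.map f.1 g.1 ∘ₗ V.act₂ W z =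
        V'.act₂ W' z ∘ₗ TensorProduct.map f.1 g.1 := by
      intro z
      induction z using TensorProduct.induction_on with
      | zero => simp
      | add z z' hz hz' => simp only [map_add, LinearMap.comp_add, LinearMap.add_comp, hz, hz']
      | tmul a b =>
        ext v w
        simp [act₂_tmul, f.2 a v, g.2 b w]
    exact LinearMap.congr_fun (key (Coalgebra.comul h)) x⟩

/-- The associativity isomorphism `(U ⊗ V) ⊗ W → U ⊗ (V ⊗ W)`. -/
noncomputable def assoc (U V W : HopfRep k H) :
    Hom ((U.tensor V).tensor W) (U.tensor (V.tensor W)) :=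
  ⟨(TensorProduct.assoc k U V W).toLinearMap, fun h x => by
    let L := (TensorProduct.assoc k U V W).toLinearMap
    let A : (H ⊗[k] H) ⊗[k] H →ₐ[k] Module.End k ((U ⊗[k] V) ⊗[k] W) :=
      Module.endTensorEndAlgHom.comp (Algebra.TensorProduct.map (U.act₂ V) W.ρ)
    let B : H ⊗[k] (H ⊗[k] H) →ₐ[k] Module.End k (U ⊗[k] (V ⊗[k] W)) :=
      Module.endTensorEndAlgHom.comp (Algebra.TensorProduct.map U.ρ (V.act₂ W))
    have hA : ∀ z : H ⊗[k] H, (U.tensor V).act₂ W z =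
        A ((Coalgebra.comul (R := k)).rTensor H z) := by
      intro z
      induction z using TensorProduct.induction_on with
      | zero => simp
      | add z z' hz hz' => simp only [map_add, hz, hz']
      | tmul a b => rfl
    have hB : ∀ z : H ⊗[k] H, U.act₂ (V.tensor W) z =
        B ((Coalgebra.comul (R := k)).lTensor H z) := by
      intro z
      induction z using TensorProduct.induction_on with
      | zero => simp
      | add z z' hz hz' => simp only [map_add, hz, hz']
      | tmul a b => rfl
    have hAB : ∀ y : (H ⊗[k] H) ⊗[k] H,
        L ∘ₗ A y = B (TensorProduct.assoc k H H H y) ∘ₗ L := by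
      intro y
      induction y using TensorProduct.induction_on with
      | zero => simp
      | add z z' hz hz' => simp only [map_add, LinearMap.comp_add, LinearMap.add_comp, hz, hz']
      | tmul z c =>
        induction z using TensorProduct.induction_on with
        | zero => simp
        | add z z' hz hz' =>
          simp only [TensorProduct.add_tmul, map_add, LinearMap.comp_add, LinearMap.add_comp,
            hz, hz']
        | tmul a b =>
          apply TensorProduct.ext_threefold
          intro u v w
          rfl
    change L ((U.tensor V).act₂ W (Coalgebra.comul (R := k) h) x) =
      U.act₂ (V.tensor W) (Coalgebra.comul (R := k) h) (L x)
    rw [hA, hB, ← Coalgebra.coassoc_apply]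
    exact LinearMap.congr_fun (hAB _) x⟩

/-- The inverse associativity isomorphism `U ⊗ (V ⊗ W) → (U ⊗ V) ⊗ W`. -/
noncomputable def assocInv (U V W : HopfRep k H) :
    Hom (U.tensor (V.tensor W)) ((U.tensor V).tensor W) :=
  ⟨(TensorProduct.assoc k U V W).symm.toLinearMap, fun h x => by
    obtain ⟨y, rfl⟩ := (TensorProduct.assoc k U V W).surjective x
    have e := (TensorProduct.assoc k U V W).symm_apply_apply y
    apply (TensorProduct.assoc k U V W).injective
    exact ((TensorProduct.assoc k U V W).apply_symm_apply _).trans (((assoc U V W).2 h y).symm.trans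
      (congrArg (fun q => TensorProduct.assoc k U V W (((U.tensor V).tensor W).ρ h q)) e.symm))⟩

/-- The unit isomorphism `k ⊗ V → V`. -/
noncomputable def lunit (V : HopfRep k H) : Hom ((unit k H).tensor V) V :=
  ⟨(TensorProduct.lid k V).toLinearMap, fun h x => by
    have key : ∀ z : H ⊗[k] H, (TensorProduct.lid k V).toLinearMap ∘ₗ (unit k H).act₂ V z =
        V.ρ (TensorProduct.lid k H ((Coalgebra.counit (R := k)).rTensor H z)) ∘ₗ
          (TensorProduct.lid k V).toLinearMap := by
      intro z
      induction z using TensorProduct.induction_on with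
      | zero => simp
      | add z z' hz hz' => simp only [map_add, LinearMap.comp_add, LinearMap.add_comp, hz, hz']
      | tmul a b =>
        refine TensorProduct.ext' fun c v => ?_
        change TensorProduct.lid k V ((unit k H).ρ a c ⊗ₜ V.ρ b v) = _
        simp [smul_smul]
    have := LinearMap.congr_fun (key (Coalgebra.comul h)) x
    rw [Coalgebra.rTensor_counit_comul, TensorProduct.lid_tmul, one_smul] at this
    exact this⟩

/-- The inverse unit isomorphism `V → k ⊗ V`. -/
noncomputable def lunitInv (V : HopfRep k H) : Hom V ((unit k H).tensor V) :=
  ⟨(TensorProduct.lid k V).symm.toLinearMap, fun h x => by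
    obtain ⟨y, rfl⟩ := (TensorProduct.lid k V).surjective x
    have e := (TensorProduct.lid k V).symm_apply_apply y
    apply (TensorProduct.lid k V).injective
    exact ((TensorProduct.lid k V).apply_symm_apply _).trans (((lunit V).2 h y).symm.trans
      (congrArg (fun q => TensorProduct.lid k V (((unit k H).tensor V).ρ h q)) e.symm))⟩

/-- The unit isomorphism `V ⊗ k → V`. -/
noncomputable def runit (V : HopfRep k H) : Hom (V.tensor (unit k H)) V :=
  ⟨(TensorProduct.rid k V).toLinearMap, fun h x => by
    have key : ∀ z : H ⊗[k] H, (TensorProduct.rid k V).toLinearMap ∘ₗ V.act₂ (unit k H) z =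
        V.ρ (TensorProduct.rid k H ((Coalgebra.counit (R := k)).lTensor H z)) ∘ₗ
          (TensorProduct.rid k V).toLinearMap := by
      intro z
      induction z using TensorProduct.induction_on with
      | zero => simp
      | add z z' hz hz' => simp only [map_add, LinearMap.comp_add, LinearMap.add_comp, hz, hz']
      | tmul a b =>
        refine TensorProduct.ext' fun v c => ?_
        change TensorProduct.rid k V (V.ρ a v ⊗ₜ (unit k H).ρ b c) = _
        simp [smul_smul, mul_comm]
    have := LinearMap.congr_fun (key (Coalgebra.comul h)) x
    rw [Coalgebra.lTensor_counit_comul, TensorProduct.rid_tmul, one_smul] at this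
    exact this⟩

/-- The inverse unit isomorphism `V → V ⊗ k`. -/
noncomputable def runitInv (V : HopfRep k H) : Hom V (V.tensor (unit k H)) :=
  ⟨(TensorProduct.rid k V).symm.toLinearMap, fun h x => by
    obtain ⟨y, rfl⟩ := (TensorProduct.rid k V).surjective x
    have e := (TensorProduct.rid k V).symm_apply_apply y
    apply (TensorProduct.rid k V).injective
    exact ((TensorProduct.rid k V).apply_symm_apply _).trans (((runit V).2 h y).symm.trans
      (congrArg (fun q => TensorProduct.rid k V ((V.tensor (unit k H)).ρ h q)) e.symm))⟩

/-- The left evaluation `V* ⊗ V → k`, `f ⊗ v ↦ f(v)`. -/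
noncomputable def ev (V : HopfRep k H) : Hom (V.dual.tensor V) (unit k H) :=
  ⟨contractLeft k V, fun h x => by
    have key : ∀ z : H ⊗[k] H, contractLeft k V ∘ₗ V.dual.act₂ V z =
        contractLeft k V ∘ₗ (V.ρ (LinearMap.mul' k H
          ((HopfAlgebra.antipode k).rTensor H z))).lTensor (Module.Dual k V) := by
      intro z
      induction z using TensorProduct.induction_on with
      | zero => simp
      | add z z' hz hz' =>
        simp only [map_add, LinearMap.comp_add, LinearMap.lTensor_add, hz, hz']
      | tmul a b =>
        refine TensorProduct.ext' fun f v => ?_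
        change contractLeft k V (V.dual.ρ a f ⊗ₜ V.ρ b v) = _
        simp
        rfl
    have := LinearMap.congr_fun (key (Coalgebra.comul h)) x
    rw [HopfAlgebra.mul_antipode_rTensor_comul_apply] at this
    refine this.trans ?_
    rw [unit_ρ]
    simp [Module.algebraMap_end_eq_smul_id, LinearMap.lTensor_smul]⟩

/-- The left coevaluation `k → V ⊗ V*`, `1 ↦ ∑ vⱼ ⊗ vⱼ*`. -/
noncomputable def coev (V : HopfRep k H) : Hom (unit k H) (V.tensor V.dual) :=
  ⟨coevaluation k V, fun h c => by
    have key : ∀ z : H ⊗[k] H, V.act₂ V.dual z (coevaluation k V 1) =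
        (V.ρ (LinearMap.mul' k H ((HopfAlgebra.antipode k).lTensor H z))).rTensor
          (Module.Dual k V) (coevaluation k V 1) := by
      intro z
      induction z using TensorProduct.induction_on with
      | zero => simp
      | add z z' hz hz' =>
        simp only [map_add, LinearMap.add_apply, LinearMap.rTensor_add, hz, hz']
      | tmul a b =>
        have e : V.act₂ V.dual (a ⊗ₜ b) = (V.ρ a).rTensor (Module.Dual k V) ∘ₗ
            (Module.Dual.transpose (R := k) (V.ρ (HopfAlgebra.antipode k b))).lTensor V :=
          TensorProduct.ext' fun v f => rfl
        rw [e, LinearMap.comp_apply, coevaluation_transpose, ← LinearMap.comp_apply,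
          ← LinearMap.rTensor_comp]
        simp
        rfl
    have h₀ := key (Coalgebra.comul h)
    rw [HopfAlgebra.mul_antipode_lTensor_comul_apply] at h₀
    have h₁ : (coevaluation k V) c = c • coevaluation k V 1 := by
      rw [← map_smul, smul_eq_mul, mul_one]
    have h₂ : (coevaluation k V) ((unit k H).ρ h c) =
        (Coalgebra.counit (R := k) h * c) • coevaluation k V 1 := by
      rw [unit_ρ, ← map_smul, smul_eq_mul, mul_one]
    refine h₂.trans ?_
    rw [h₁, map_smul]
    refine Eq.trans ?_ (congrArg (c • ·) h₀.symm)
    simp [Module.algebraMap_end_eq_smul_id, LinearMap.rTensor_smul, smul_smul, mul_comm]⟩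

/-- The right evaluation `V ⊗ V* → k`, `v ⊗ f ↦ f(g v)`. -/
noncomputable def evR (g : Pivot k H) (V : HopfRep k H) : Hom (V.tensor V.dual) (unit k H) :=
  ⟨contractRight k V ∘ₗ (V.ρ g.val).rTensor (Module.Dual k V), fun h x => by
    have hg : ∀ y : H, (g.val : H) * y =
        HopfAlgebra.antipode k (HopfAlgebra.antipode k y) * g.val := fun y => by
      simp [g.antipode_antipode, mul_assoc]
    have key : ∀ z : H ⊗[k] H,
        contractRight k V ∘ₗ (V.ρ g.val).rTensor (Module.Dual k V) ∘ₗ V.act₂ V.dual z =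
        contractRight k V ∘ₗ (V.ρ (HopfAlgebra.antipode k (LinearMap.mul' k H
          ((HopfAlgebra.antipode k).rTensor H z)) * g.val)).rTensor (Module.Dual k V) := by
      intro z
      induction z using TensorProduct.induction_on with
      | zero => simp
      | add z z' hz hz' =>
        simp only [map_add, LinearMap.comp_add, add_mul, LinearMap.rTensor_add, hz, hz']
      | tmul a b =>
        refine TensorProduct.ext' fun v f => ?_
        change f (V.ρ (HopfAlgebra.antipode k b) (V.ρ g.val (V.ρ a v))) = _
        rw [← Module.End.mul_apply (V.ρ g.val), ← map_mul, hg]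
        simp [HopfAlgebra.antipode_mul_antidistrib]
    have := LinearMap.congr_fun (key (Coalgebra.comul h)) x
    rw [HopfAlgebra.mul_antipode_rTensor_comul_apply] at this
    refine this.trans ?_
    rw [unit_ρ]
    simp [Algebra.algebraMap_eq_smul_one, LinearMap.rTensor_smul]⟩

/-- The right coevaluation `k → V* ⊗ V`, `1 ↦ ∑ vⱼ* ⊗ g⁻¹ vⱼ`. -/
noncomputable def coevR (g : Pivot k H) (V : HopfRep k H) : Hom (unit k H) (V.dual.tensor V) :=
  ⟨(V.ρ ((g.val⁻¹ : Hˣ) : H)).lTensor (Module.Dual k V) ∘ₗ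
      (TensorProduct.comm k V (Module.Dual k V)).toLinearMap ∘ₗ coevaluation k V, fun h c => by
    have hg : ∀ y : H, ((g.val⁻¹ : Hˣ) : H) *
        HopfAlgebra.antipode k (HopfAlgebra.antipode k y) = y * ((g.val⁻¹ : Hˣ) : H) := fun y => by
      simp [g.antipode_antipode, ← mul_assoc]
    let c₀ : Module.Dual k V ⊗[k] V :=
      TensorProduct.comm k V (Module.Dual k V) (coevaluation k V 1)
    have hc : ∀ T : V →ₗ[k] V, (Module.Dual.transpose (R := k) T).rTensor V c₀ =
        T.lTensor (Module.Dual k V) c₀ := fun T => by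
      have := congrArg (TensorProduct.comm k V (Module.Dual k V)) (V.coevaluation_transpose T)
      simpa only [c₀, LinearMap.rTensor, LinearMap.lTensor, TensorProduct.map_comm] using this
    have key : ∀ z : H ⊗[k] H, V.dual.act₂ V z
        ((V.ρ ((g.val⁻¹ : Hˣ) : H)).lTensor (Module.Dual k V) c₀) =
        (V.ρ (((g.val⁻¹ : Hˣ) : H) * HopfAlgebra.antipode k (LinearMap.mul' k H
          ((HopfAlgebra.antipode k).lTensor H z)))).lTensor (Module.Dual k V) c₀ := by
      intro z
      induction z using TensorProduct.induction_on with
      | zero => simp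
      | add z z' hz hz' =>
        simp only [map_add, mul_add, LinearMap.add_apply, LinearMap.lTensor_add, hz, hz']
      | tmul a b =>
        have e : V.dual.act₂ V (a ⊗ₜ b) ∘ₗ
            (V.ρ ((g.val⁻¹ : Hˣ) : H)).lTensor (Module.Dual k V) =
            (V.ρ (b * ((g.val⁻¹ : Hˣ) : H))).lTensor (Module.Dual k V) ∘ₗ
            (Module.Dual.transpose (R := k) (V.ρ (HopfAlgebra.antipode k a))).rTensor V := by
          refine TensorProduct.ext' fun v f => ?_
          rw [map_mul]
          rfl
        rw [← LinearMap.comp_apply, e, LinearMap.comp_apply, hc, ← LinearMap.comp_apply,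
          ← LinearMap.lTensor_comp, ← Module.End.mul_eq_comp, ← map_mul, ← hg]
        simp [HopfAlgebra.antipode_mul_antidistrib, mul_assoc]
    have h₀ := key (Coalgebra.comul h)
    rw [HopfAlgebra.mul_antipode_lTensor_comul_apply] at h₀
    have h₁ : ∀ d : k, coevaluation k V d = d • coevaluation k V 1 := fun d => by
      rw [← map_smul, smul_eq_mul, mul_one]
    simp only [LinearMap.comp_apply, LinearEquiv.coe_coe]
    rw [h₁ c, h₁ ((unit k H).ρ h c), unit_ρ, map_smul, map_smul, map_smul, map_smul, map_smul]
    refine Eq.trans ?_ (congrArg (c • ·) h₀.symm)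
    simp [Algebra.algebraMap_eq_smul_one, LinearMap.lTensor_smul, smul_smul, mul_comm, c₀]⟩

end Hom

/-- The isomorphism `Hom(W, U ⊗ V) → Hom(W ⊗ V*, U)`, `f ↦ (id ⊗ evR) ∘ (f ⊗ id)`. -/
noncomputable def capRight (g : Pivot k H) {U V W : HopfRep k H} (f : Hom W (U.tensor V)) :
    Hom (W.tensor V.dual) U :=
  Hom.comp (Hom.runit U) (Hom.comp (Hom.tensor (Hom.id U) (Hom.evR g V))
    (Hom.comp (Hom.assoc U V V.dual) (Hom.tensor f (Hom.id V.dual))))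

/-- The isomorphism `Hom(U ⊗ V, W) → Hom(U, W ⊗ V*)`, `f ↦ (f ⊗ id) ∘ (id ⊗ coev)`. -/
noncomputable def cupRight {U V W : HopfRep k H} (f : Hom (U.tensor V) W) :
    Hom U (W.tensor V.dual) :=
  Hom.comp (Hom.tensor f (Hom.id V.dual)) (Hom.comp (Hom.assocInv U V V.dual)
    (Hom.comp (Hom.tensor (Hom.id U) (Hom.coev V)) (Hom.runitInv U)))

/-- The isomorphism `Hom(W, U ⊗ V) → Hom(U* ⊗ W, V)`, `f ↦ (ev ⊗ id) ∘ (id ⊗ f)`. -/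
noncomputable def capLeft {U V W : HopfRep k H} (f : Hom W (U.tensor V)) :
    Hom (U.dual.tensor W) V :=
  Hom.comp (Hom.lunit V) (Hom.comp (Hom.tensor (Hom.ev U) (Hom.id V))
    (Hom.comp (Hom.assocInv U.dual U V) (Hom.tensor (Hom.id U.dual) f)))

/-- The isomorphism `Hom(U ⊗ V, W) → Hom(V, U* ⊗ W)`, `f ↦ (id ⊗ f) ∘ (coevR ⊗ id)`. -/
noncomputable def cupLeft (g : Pivot k H) {U V W : HopfRep k H} (f : Hom (U.tensor V) W) :
    Hom V (U.dual.tensor W) :=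
  Hom.comp (Hom.tensor (Hom.id U.dual) f) (Hom.comp (Hom.assoc U.dual U V)
    (Hom.comp (Hom.tensor (Hom.coevR g U) (Hom.id V)) (Hom.lunitInv V)))

section Projective

lemma IsProjective.lift {P M N : HopfRep k H} (hP : P.IsProjective) (p : Hom M N)
    (hp : Function.Surjective p.1) (f : Hom P N) : ∃ l : Hom P M, Hom.comp p l = f := by
  have : Module.Projective H P.AsModule := hP
  let p' : M.AsModule →ₗ[H] N.AsModule :=
    { toFun := p.1, map_add' := map_add p.1, map_smul' := p.2 }
  let f' : P.AsModule →ₗ[H] N.AsModule :=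
    { toFun := f.1, map_add' := map_add f.1, map_smul' := f.2 }
  obtain ⟨l, hl⟩ := Module.projective_lifting_property p' f' hp
  refine ⟨⟨{ toFun := l, map_add' := map_add l, map_smul' := fun c x => ?_ }, l.map_smul⟩, ?_⟩
  · have h₁ := l.map_smul (algebraMap k H c) x
    change l (P.ρ (algebraMap k H c) x) = M.ρ (algebraMap k H c) (l x) at h₁
    rw [AlgHom.commutes, AlgHom.commutes] at h₁
    exact h₁
  · ext x
    exact LinearMap.congr_fun hl x

lemma isProjective_of_split [FiniteDimensional k H] {P : HopfRep k H}
    (h : ∀ (M : HopfRep k H) (p : Hom M P), Function.Surjective p.1 →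
      ∃ s : Hom P M, ∀ x, p.1 (s.1 x) = x) : P.IsProjective := by
  let b := Module.finBasis k P
  let M : HopfRep k H :=
    { carrier := Fin (Module.finrank k P) → H, ρ := Algebra.lsmul k k (Fin _ → H) }
  let p : Hom M P := ⟨∑ i, (LinearMap.applyₗ (b i) ∘ₗ P.ρ.toLinearMap) ∘ₗ LinearMap.proj i,
    fun h x => by
      change (∑ i, (LinearMap.applyₗ (b i) ∘ₗ P.ρ.toLinearMap) ∘ₗ LinearMap.proj i)
        (fun i => h * x i) = _
      simp [LinearMap.sum_apply]
      rfl⟩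
  have hp : Function.Surjective p.1 := fun x => by
    refine ⟨fun i => algebraMap k H (b.repr x i), ?_⟩
    change (∑ i, (LinearMap.applyₗ (b i) ∘ₗ P.ρ.toLinearMap) ∘ₗ LinearMap.proj i)
        (fun i => algebraMap k H (b.repr x i)) = _
    simp [LinearMap.sum_apply, Module.algebraMap_end_apply, b.sum_repr]
  obtain ⟨s, hs⟩ := h M p hp
  let p' : (Fin (Module.finrank k P) → H) →ₗ[H] P.AsModule :=
    { toFun := p.1, map_add' := map_add p.1, map_smul' := p.2 }
  let s' : P.AsModule →ₗ[H] (Fin (Module.finrank k P) → H) :=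
    { toFun := s.1, map_add' := map_add s.1, map_smul' := s.2 }
  exact Module.Projective.of_split s' p' (LinearMap.ext hs)

/-- The tensor product of a projective module with any module is projective. -/
lemma IsProjective.tensor [FiniteDimensional k H] {U : HopfRep k H} (hU : U.IsProjective)
    (V : HopfRep k H) : (U.tensor V).IsProjective := by
  refine isProjective_of_split fun M p hp => ?_
  obtain ⟨l, hl⟩ := hU.lift (Hom.tensor p (Hom.id V.dual))
    (TensorProduct.map_surjective hp (fun x => ⟨x, rfl⟩)) (cupRight (Hom.id (U.tensor V)))
  let R (N : HopfRep k H) : Hom ((N.tensor V.dual).tensor V) N :=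
    Hom.comp (Hom.runit N) (Hom.comp (Hom.tensor (Hom.id N) (Hom.ev V)) (Hom.assoc N V.dual V))
  have hR : ∀ z, p.1 ((R M).1 z) =
      (R (U.tensor V)).1 ((Hom.tensor (Hom.tensor p (Hom.id V.dual)) (Hom.id V)).1 z) := by
    refine LinearMap.congr_fun (f := p.1 ∘ₗ (R M).1) (g := (R (U.tensor V)).1 ∘ₗ
      (Hom.tensor (Hom.tensor p (Hom.id V.dual)) (Hom.id V)).1) ?_
    apply TensorProduct.ext_threefold
    intro m f v
    exact map_smul p.1 (f v) m
  refine ⟨Hom.comp (R M) (Hom.tensor l (Hom.id V)), ?_⟩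
  refine LinearMap.congr_fun (g := LinearMap.id)
    (f := p.1 ∘ₗ (R M).1 ∘ₗ (Hom.tensor l (Hom.id V)).1) ?_
  refine TensorProduct.ext' fun u v => ?_
  have hu : (Hom.tensor p (Hom.id V.dual)).1 (l.1 u) =
      (cupRight (Hom.id (U.tensor V))).1 u := LinearMap.congr_fun (congrArg Subtype.val hl) u
  have hc : ∀ c : V ⊗[k] Module.Dual k V, (R (U.tensor V)).1
      ((TensorProduct.map LinearMap.id LinearMap.id
        ((TensorProduct.assoc k U V (Module.Dual k V)).symm (u ⊗ₜ c))) ⊗ₜ v) =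
      u ⊗ₜ TensorProduct.rid k V ((contractLeft k V).lTensor V
        (TensorProduct.assoc k V (Module.Dual k V) V (c ⊗ₜ v))) := by
    intro c
    induction c using TensorProduct.induction_on with
    | zero => simp
    | add c c' hc hc' => simp only [TensorProduct.tmul_add, TensorProduct.add_tmul, map_add, hc, hc']
    | tmul w f =>
      change f v • (u ⊗ₜ[k] w) = u ⊗ₜ (f v • w)
      rw [TensorProduct.tmul_smul]
  have hz := LinearMap.congr_fun (contractLeft_assoc_coevaluation' k V) ((1 : k) ⊗ₜ v)
  have h₁ := (hR (l.1 u ⊗ₜ v))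
  refine h₁.trans ?_
  change (R (U.tensor V)).1 ((Hom.tensor p (Hom.id V.dual)).1 (l.1 u) ⊗ₜ v) = _
  rw [hu]
  refine (hc (coevaluation k V 1)).trans ?_
  change u ⊗ₜ TensorProduct.rid k V ((contractLeft k V).lTensor V
    (TensorProduct.assoc k V (Module.Dual k V) V ((coevaluation k V).rTensor V (1 ⊗ₜ v)))) = _
  simp only [LinearMap.comp_apply, LinearEquiv.coe_coe] at hz
  rw [hz]
  simp

end Projective

end HopfRep

/-- The category `H`-pmod of finite-dimensional projective `H`-modules, as a full subcategory. -/
structure HopfProj (k H : Type u) [Field k] [Ring H] [HopfAlgebra k H] where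
  obj : HopfRep k H
  isProjective : obj.IsProjective

namespace HopfProj

variable {k H : Type u} [Field k] [Ring H] [HopfAlgebra k H]

abbrev Hom (P Q : HopfProj k H) : Submodule k (P.obj →ₗ[k] Q.obj) := HopfRep.Hom P.obj Q.obj

noncomputable def tensor [FiniteDimensional k H] (P Q : HopfProj k H) : HopfProj k H :=
  ⟨P.obj.tensor Q.obj, P.isProjective.tensor Q.obj⟩

end HopfProj

/-- Families of linear forms `t_P : End_H(P) → k`, `P` in `H`-pmod. -/
abbrev TraceFamily (k H : Type u) [Field k] [Ring H] [HopfAlgebra k H] : Type (u + 1) :=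
  ∀ P : HopfProj k H, HopfProj.Hom P P →ₗ[k] k

namespace TraceFamily

variable {k H : Type u} [Field k] [Ring H] [HopfAlgebra k H]

/-- `t` is a Calabi–Yau structure on `H`-pmod: it is cyclic, and the pairings
`Hom(V, W) × Hom(W, V) → k`, `(f, g) ↦ t_W (f ∘ g)` are non-degenerate. -/
structure IsCalabiYau (t : TraceFamily k H) : Prop where
  cyclic : ∀ {V W : HopfProj k H} (f : HopfProj.Hom V W) (g : HopfProj.Hom W V),
    t V (HopfRep.Hom.comp g f) = t W (HopfRep.Hom.comp f g)
  nondegenerate_left : ∀ {V W : HopfProj k H} (f : HopfProj.Hom V W),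
    (∀ g : HopfProj.Hom W V, t W (HopfRep.Hom.comp f g) = 0) → f = 0
  nondegenerate_right : ∀ {V W : HopfProj k H} (g : HopfProj.Hom W V),
    (∀ f : HopfProj.Hom V W, t W (HopfRep.Hom.comp f g) = 0) → g = 0

/-- Compatibility with duality on the right: for `a : U ⊗ V → W` and `b : W → U ⊗ V`,
`t_{U ⊗ V} (b ∘ a) = t_U (b' ∘ a')`, where `a' : U → W ⊗ V*` and `b' : W ⊗ V* → U` correspond to
`a` and `b` under duality. -/
def IsRightCompatible [FiniteDimensional k H] (g : Pivot k H) (t : TraceFamily k H) : Prop :=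
  ∀ (U V W : HopfProj k H) (a : HopfProj.Hom (U.tensor V) W) (b : HopfProj.Hom W (U.tensor V)),
    t (U.tensor V) (HopfRep.Hom.comp b a) =
      t U (HopfRep.Hom.comp (HopfRep.capRight g b) (HopfRep.cupRight a))

/-- Compatibility with duality on the left: for `a : U ⊗ V → W` and `b : W → U ⊗ V`,
`t_{U ⊗ V} (b ∘ a) = t_V (b' ∘ a')`, where `a' : V → U* ⊗ W` and `b' : U* ⊗ W → V` correspond to
`a` and `b` under duality. -/
def IsLeftCompatible [FiniteDimensional k H] (g : Pivot k H) (t : TraceFamily k H) : Prop :=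
  ∀ (U V W : HopfProj k H) (a : HopfProj.Hom (U.tensor V) W) (b : HopfProj.Hom W (U.tensor V)),
    t (U.tensor V) (HopfRep.Hom.comp b a) =
      t V (HopfRep.Hom.comp (HopfRep.capLeft b) (HopfRep.cupLeft g a))

end TraceFamily

/-!
The category `H`-pmod is controlled by the regular module. Every projective `P` has a finite dual
basis `(eᵢ, pᵢ)` (`HopfRep.Frame`), and for a symmetric linear form `λ` on `H` the expression
`∑ λ(pᵢ(f(eᵢ)))` is a cyclic trace on `End_H(P)` that does not depend on the dual basis. Conversely
a cyclic family `t` is recovered in this way from the form `λ(x) = t_H(· x)`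
(`TraceFamily.ofForm_form`), and non-degeneracy of `λ` gives non-degeneracy of the family.

Compatibility with duality becomes a condition on `λ`. If `(eᵢ, pᵢ)` is a dual basis of `U` and
`(vⱼ)` a basis of `V`, then the vectors `eᵢ ⊗ vⱼ` and the maps `u ⊗ v ↦ pᵢ(u)₁ vⱼ*(S(pᵢ(u)₂) v)`
form a dual basis of `U ⊗ V`. Comparing the trace in this basis with the trace of the right partial
trace shows that compatibility on the right means `(λ ⊗ id) Δ(x) = λ(x) g⁻¹`, which says that
`λ(g⁻¹ ·)` is a right integral; on the left one finds `(id ⊗ λ) Δ(x) = λ(x) g`, so that `λ(g ·)` is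
a left integral (`TraceFamily.isRightCompatible_iff`, `TraceFamily.isLeftCompatible_iff`). The
statements about unibalanced `(H, g)` then reduce to comparing two lines of forms.

It remains to see that these forms make up a line spanned by a symmetric non-degenerate form. The
partial trace of `a ↦ (1 ⊗ g) Δ(a) (1 ⊗ x)` is a cointegral, and it is non-zero for some `x` since
composing with `S⁻¹` and taking the trace gives `ε(g) = 1`; here the pivot makes the antipode
invertible, `S⁻¹(x) = g⁻¹ S(x) g`. By unimodularity there is a non-zero two-sided cointegral `c`.
The map `φ ↦ φ(c₁) c₂` is a bijection `H* → H`, the wanted forms are the multiples of the preimage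
`λ` of `g⁻¹`, and `c₁ ⊗ x c₂ = S(x) c₁ ⊗ c₂`, `c₁ x ⊗ c₂ = c₁ ⊗ c₂ S(x)` give
`λ(S(x) c₁) c₂ = x g⁻¹ = λ(c₁ S(x)) c₂`: the first equality implies that `λ` is non-degenerate, and
the two together, by injectivity of `φ ↦ φ(c₁) c₂`, that it is symmetric.
-/


/-! ### Contractions of the coproduct and the antipode -/

section HopfAlgebra

open Coalgebra HopfAlgebra

variable {k H : Type u} [Field k] [Ring H] [HopfAlgebra k H]

/-- The contraction `x ⊗ y ↦ φ(x) y` of the first tensor factor. -/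
noncomputable def contractFst (φ : H →ₗ[k] k) : H ⊗[k] H →ₗ[k] H :=
  (TensorProduct.lid k H).toLinearMap ∘ₗ φ.rTensor H

/-- The contraction `x ⊗ y ↦ φ(y) x` of the second tensor factor. -/
noncomputable def contractSnd (φ : H →ₗ[k] k) : H ⊗[k] H →ₗ[k] H :=
  (TensorProduct.rid k H).toLinearMap ∘ₗ φ.lTensor H

@[simp]
lemma contractFst_tmul (φ : H →ₗ[k] k) (x y : H) : contractFst φ (x ⊗ₜ y) = φ x • y := by
  simp [contractFst]

@[simp]
lemma contractSnd_tmul (φ : H →ₗ[k] k) (x y : H) : contractSnd φ (x ⊗ₜ y) = φ y • x := by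
  simp [contractSnd]

lemma contractFst_mul_tmul (φ : H →ₗ[k] k) (z : H ⊗[k] H) (a b : H) :
    contractFst φ (z * (a ⊗ₜ b)) = contractFst (φ ∘ₗ LinearMap.mulRight k a) z * b := by
  induction z using TensorProduct.induction_on with
  | zero => simp
  | add z w hz hw => simp only [add_mul, map_add, hz, hw]
  | tmul x y => simp

lemma contractFst_tmul_mul (φ : H →ₗ[k] k) (z : H ⊗[k] H) (a b : H) :
    contractFst φ ((a ⊗ₜ b) * z) = b * contractFst (φ ∘ₗ LinearMap.mulLeft k a) z := by
  induction z using TensorProduct.induction_on with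
  | zero => simp
  | add z w hz hw => simp only [mul_add, map_add, hz, hw]
  | tmul x y => simp

lemma contractSnd_mul_tmul (φ : H →ₗ[k] k) (z : H ⊗[k] H) (a b : H) :
    contractSnd φ (z * (a ⊗ₜ b)) = contractSnd (φ ∘ₗ LinearMap.mulRight k b) z * a := by
  induction z using TensorProduct.induction_on with
  | zero => simp
  | add z w hz hw => simp only [add_mul, map_add, hz, hw]
  | tmul x y => simp

lemma contractSnd_tmul_mul (φ : H →ₗ[k] k) (z : H ⊗[k] H) (a b : H) :
    contractSnd φ ((a ⊗ₜ b) * z) = a * contractSnd (φ ∘ₗ LinearMap.mulLeft k b) z := by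
  induction z using TensorProduct.induction_on with
  | zero => simp
  | add z w hz hw => simp only [mul_add, map_add, hz, hw]
  | tmul x y => simp

lemma mulRight_one_eq_id : LinearMap.mulRight k (1 : H) = LinearMap.id := by ext; simp

lemma mulLeft_one_eq_id : LinearMap.mulLeft k (1 : H) = LinearMap.id := by ext; simp

/-- The two contractions are transposes of each other. -/
lemma apply_contractFst (φ ψ : H →ₗ[k] k) (z : H ⊗[k] H) :
    ψ (contractFst φ z) = φ (contractSnd ψ z) := by
  induction z using TensorProduct.induction_on with
  | zero => simp
  | add z w hz hw => simp only [map_add, hz, hw]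
  | tmul x y => simp [mul_comm]

/-- The map `x ↦ φ(x₁) x₂` is right colinear. -/
lemma comul_contractFst_comul (φ : H →ₗ[k] k) (x : H) :
    comul (R := k) (contractFst φ (comul x)) =
      (contractFst φ ∘ₗ comul).rTensor H (comul (R := k) x) := by
  have h₁ : ∀ z : H ⊗[k] H, comul (R := k) (contractFst φ z) =
      TensorProduct.lid k (H ⊗[k] H) (φ.rTensor (H ⊗[k] H) ((comul (R := k)).lTensor H z)) := by
    intro z
    induction z using TensorProduct.induction_on with
    | zero => simp
    | add z w hz hw => simp only [map_add, hz, hw]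
    | tmul x y => simp
  have h₂ : ∀ z : (H ⊗[k] H) ⊗[k] H, TensorProduct.lid k (H ⊗[k] H)
      (φ.rTensor (H ⊗[k] H) (TensorProduct.assoc k H H H z)) = (contractFst φ).rTensor H z := by
    intro z
    induction z using TensorProduct.induction_on with
    | zero => simp
    | add z w hz hw => simp only [map_add, hz, hw]
    | tmul z c =>
      induction z using TensorProduct.induction_on with
      | zero => simp
      | add z w hz hw => simp only [TensorProduct.add_tmul, map_add, hz, hw]
      | tmul x y => simp [TensorProduct.smul_tmul']
  rw [h₁, ← coassoc_apply, h₂, LinearMap.rTensor_comp_apply]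

/-- The map `x ↦ x₁ φ(x₂)` is left colinear. -/
lemma comul_contractSnd_comul (φ : H →ₗ[k] k) (x : H) :
    comul (R := k) (contractSnd φ (comul x)) =
      (contractSnd φ ∘ₗ comul).lTensor H (comul (R := k) x) := by
  have h₁ : ∀ z : H ⊗[k] H, comul (R := k) (contractSnd φ z) =
      TensorProduct.rid k (H ⊗[k] H) (φ.lTensor (H ⊗[k] H) ((comul (R := k)).rTensor H z)) := by
    intro z
    induction z using TensorProduct.induction_on with
    | zero => simp
    | add z w hz hw => simp only [map_add, hz, hw]
    | tmul x y => simp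
  have h₂ : ∀ z : (H ⊗[k] H) ⊗[k] H, TensorProduct.rid k (H ⊗[k] H)
      (φ.lTensor (H ⊗[k] H) z) =
        (contractSnd φ).lTensor H (TensorProduct.assoc k H H H z) := by
    intro z
    induction z using TensorProduct.induction_on with
    | zero => simp
    | add z w hz hw => simp only [map_add, hz, hw]
    | tmul z c =>
      induction z using TensorProduct.induction_on with
      | zero => simp
      | add z w hz hw => simp only [TensorProduct.add_tmul, map_add, hz, hw]
      | tmul x y => simp
  rw [h₁, h₂, coassoc_apply, LinearMap.lTensor_comp_apply]

/-- If `m(Δ y) = ε(y) u` then `y₁ ⊗ m(y₂ ⊗ y₃) = y ⊗ u`. The left-hand side is given as a map `F`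
applied to `Δ(y₁) ⊗ y₂`, so that `F` can be an expression in the algebra `H ⊗ H`. -/
lemma sum_comul_left_eq {ι : Type*} {y u : H} (r : Coalgebra.Repr k y ι)
    (m : H ⊗[k] H →ₗ[k] H) (hm : ∀ y, m (comul (R := k) y) = counit (R := k) y • u)
    (F : (H ⊗[k] H) ⊗[k] H →ₗ[k] H ⊗[k] H)
    (hF : ∀ a b c : H, F ((a ⊗ₜ b) ⊗ₜ c) = a ⊗ₜ m (b ⊗ₜ c)) :
    ∑ i ∈ r.index, F (comul (R := k) (r.left i) ⊗ₜ r.right i) = y ⊗ₜ u := by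
  have hF' : F = m.lTensor H ∘ₗ (TensorProduct.assoc k H H H).toLinearMap := by
    apply TensorProduct.ext_threefold
    intro a b c
    simp [hF]
  have h := congrArg (m.lTensor H) (coassoc_apply (R := k) y)
  have h' := congrArg (LinearMap.lTensor H (LinearMap.toSpanSingleton k H u))
    (lTensor_counit_comul (R := k) y)
  rw [← r.eq] at h h'
  simp only [map_sum, LinearMap.rTensor_tmul, LinearMap.lTensor_tmul, hm,
    LinearMap.toSpanSingleton_apply, one_smul] at h h'
  simp only [hF', LinearMap.comp_apply, LinearEquiv.coe_coe]
  rw [h, h']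

/-- If `m(Δ y) = ε(y) u` then `m(y₁ ⊗ y₂) ⊗ y₃ = u ⊗ y`. -/
lemma sum_comul_right_eq {ι : Type*} {y u : H} (r : Coalgebra.Repr k y ι)
    (m : H ⊗[k] H →ₗ[k] H) (hm : ∀ y, m (comul (R := k) y) = counit (R := k) y • u)
    (F : H ⊗[k] (H ⊗[k] H) →ₗ[k] H ⊗[k] H)
    (hF : ∀ a b c : H, F (a ⊗ₜ (b ⊗ₜ c)) = m (a ⊗ₜ b) ⊗ₜ c) :
    ∑ i ∈ r.index, F (r.left i ⊗ₜ comul (R := k) (r.right i)) = u ⊗ₜ y := by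
  have hF' : F ∘ₗ (TensorProduct.assoc k H H H).toLinearMap = m.rTensor H := by
    apply TensorProduct.ext_threefold
    intro a b c
    simp [hF]
  have h := congrArg F (coassoc_apply (R := k) y)
  have h' := congrArg (LinearMap.rTensor H (LinearMap.toSpanSingleton k H u))
    (rTensor_counit_comul (R := k) y)
  have h'' := LinearMap.congr_fun hF' ((comul (R := k)).rTensor H (comul (R := k) y))
  simp only [LinearMap.comp_apply, LinearEquiv.coe_coe] at h''
  rw [h''] at h
  rw [← r.eq] at h h'
  simp only [map_sum, LinearMap.rTensor_tmul, LinearMap.lTensor_tmul, hm,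
    LinearMap.toSpanSingleton_apply, one_smul] at h h'
  rw [← h, h']

/-- `Δ(y₁) (1 ⊗ S(y₂)) = y ⊗ 1`. -/
lemma sum_comul_mul_one_tmul_antipode {ι : Type*} {y : H} (r : Coalgebra.Repr k y ι) :
    ∑ i ∈ r.index, comul (R := k) (r.left i) * (1 ⊗ₜ antipode k (r.right i)) =
      y ⊗ₜ (1 : H) := by
  let F : (H ⊗[k] H) ⊗[k] H →ₗ[k] H ⊗[k] H := LinearMap.mul' k (H ⊗[k] H) ∘ₗ
    (TensorProduct.mk k H H 1 ∘ₗ antipode k).lTensor (H ⊗[k] H)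
  refine sum_comul_left_eq r (LinearMap.mul' k H ∘ₗ (antipode k).lTensor H)
    (fun y => ?_) F (fun a b c => ?_)
  · simp [Algebra.algebraMap_eq_smul_one]
  · simp [F]

/-- `(S(y₁) ⊗ 1) Δ(y₂) = 1 ⊗ y`. -/
lemma sum_antipode_tmul_one_mul_comul {ι : Type*} {y : H} (r : Coalgebra.Repr k y ι) :
    ∑ i ∈ r.index, (antipode k (r.left i) ⊗ₜ 1) * comul (R := k) (r.right i) =
      (1 : H) ⊗ₜ y := by
  let F : H ⊗[k] (H ⊗[k] H) →ₗ[k] H ⊗[k] H := LinearMap.mul' k (H ⊗[k] H) ∘ₗ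
    ((TensorProduct.mk k H H).flip 1 ∘ₗ antipode k).rTensor (H ⊗[k] H)
  refine sum_comul_right_eq r (LinearMap.mul' k H ∘ₗ (antipode k).rTensor H)
    (fun y => ?_) F (fun a b c => ?_)
  · simp [Algebra.algebraMap_eq_smul_one]
  · simp [F]

namespace Pivot

variable (g : Pivot k H)

lemma antipode_val : antipode k (g.val : H) = ((g.val⁻¹ : Hˣ) : H) :=
  (Units.inv_eq_of_mul_eq_one_right g.isGroupLike.mul_antipode_cancel).symm

lemma isGroupLikeElem_inv : IsGroupLikeElem k ((g.val⁻¹ : Hˣ) : H) := by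
  rw [← antipode_val]
  exact g.isGroupLike.antipode

lemma antipode_inv : antipode k ((g.val⁻¹ : Hˣ) : H) = (g.val : H) := by
  rw [← antipode_val, g.antipode_antipode]
  simp

/-- The inverse of the antipode, `x ↦ g⁻¹ S(x) g`. -/
noncomputable def antipodeInv : H →ₗ[k] H :=
  LinearMap.mulLeft k ((g.val⁻¹ : Hˣ) : H) ∘ₗ LinearMap.mulRight k (g.val : H) ∘ₗ antipode k

lemma antipodeInv_apply (x : H) :
    g.antipodeInv x = ((g.val⁻¹ : Hˣ) : H) * antipode k x * g.val := by
  simp [antipodeInv, mul_assoc]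

@[simp]
lemma antipodeInv_antipode (x : H) : g.antipodeInv (antipode k x) = x := by
  rw [antipodeInv_apply, g.antipode_antipode]
  simp [mul_assoc]

@[simp]
lemma antipode_antipodeInv (x : H) : antipode k (g.antipodeInv x) = x := by
  rw [antipodeInv_apply, antipode_mul_antidistrib, antipode_mul_antidistrib, g.antipode_antipode,
    antipode_val, antipode_inv]
  simp [mul_assoc]

lemma antipode_injective (g : Pivot k H) : Function.Injective (antipode k (A := H)) :=
  Function.LeftInverse.injective g.antipodeInv_antipode

lemma antipode_surjective (g : Pivot k H) : Function.Surjective (antipode k (A := H)) :=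
  Function.RightInverse.surjective g.antipode_antipodeInv

/-- `S⁻¹(y₂) y₁ = ε(y)`. -/
lemma antipodeInv_mul_comul (y : H) :
    (LinearMap.mul' k H ∘ₗ (TensorProduct.comm k H H).toLinearMap ∘ₗ g.antipodeInv.lTensor H)
      (comul (R := k) y) = counit (R := k) y • (1 : H) := by
  apply g.antipode_injective
  have h := mul_antipode_rTensor_comul_apply (R := k) y
  rw [← (ℛ k y).eq] at h ⊢
  simpa [antipode_mul_antidistrib, Algebra.algebraMap_eq_smul_one] using h

/-- `y₂ S⁻¹(y₁) = ε(y)`. -/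
lemma mul_antipodeInv_comul (y : H) :
    (LinearMap.mul' k H ∘ₗ (TensorProduct.comm k H H).toLinearMap ∘ₗ g.antipodeInv.rTensor H)
      (comul (R := k) y) = counit (R := k) y • (1 : H) := by
  apply g.antipode_injective
  have h := mul_antipode_lTensor_comul_apply (R := k) y
  rw [← (ℛ k y).eq] at h ⊢
  simpa [antipode_mul_antidistrib, Algebra.algebraMap_eq_smul_one] using h

/-- `(1 ⊗ S⁻¹(y₂)) Δ(y₁) = y ⊗ 1`. -/
lemma sum_one_tmul_antipodeInv_mul_comul {ι : Type*} {y : H} (r : Coalgebra.Repr k y ι) :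
    ∑ i ∈ r.index, (1 ⊗ₜ g.antipodeInv (r.right i)) * comul (R := k) (r.left i) =
      y ⊗ₜ (1 : H) := by
  let F : (H ⊗[k] H) ⊗[k] H →ₗ[k] H ⊗[k] H := LinearMap.mul' k (H ⊗[k] H) ∘ₗ
    (TensorProduct.comm k (H ⊗[k] H) (H ⊗[k] H)).toLinearMap ∘ₗ
    (TensorProduct.mk k H H 1 ∘ₗ g.antipodeInv).lTensor (H ⊗[k] H)
  have hF : ∀ (z : H ⊗[k] H) (c : H), F (z ⊗ₜ c) = (1 ⊗ₜ g.antipodeInv c) * z := by simp [F]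
  simp_rw [← hF]
  refine sum_comul_left_eq r (LinearMap.mul' k H ∘ₗ (TensorProduct.comm k H H).toLinearMap ∘ₗ
    g.antipodeInv.lTensor H) g.antipodeInv_mul_comul F (fun a b c => by simp [F])

/-- `Δ(y₂) (S⁻¹(y₁) ⊗ 1) = 1 ⊗ y`. -/
lemma sum_comul_mul_antipodeInv_tmul_one {ι : Type*} {y : H} (r : Coalgebra.Repr k y ι) :
    ∑ i ∈ r.index, comul (R := k) (r.right i) * (g.antipodeInv (r.left i) ⊗ₜ 1) =
      (1 : H) ⊗ₜ y := by
  let F : H ⊗[k] (H ⊗[k] H) →ₗ[k] H ⊗[k] H := LinearMap.mul' k (H ⊗[k] H) ∘ₗ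
    (TensorProduct.comm k (H ⊗[k] H) (H ⊗[k] H)).toLinearMap ∘ₗ
    ((TensorProduct.mk k H H).flip 1 ∘ₗ g.antipodeInv).rTensor (H ⊗[k] H)
  have hF : ∀ (z : H ⊗[k] H) (c : H), F (c ⊗ₜ z) = z * (g.antipodeInv c ⊗ₜ 1) := by simp [F]
  simp_rw [← hF]
  refine sum_comul_right_eq r (LinearMap.mul' k H ∘ₗ (TensorProduct.comm k H H).toLinearMap ∘ₗ
    g.antipodeInv.rTensor H) g.mul_antipodeInv_comul F (fun a b c => by simp [F])

end Pivot

end HopfAlgebra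

/-! ### Cointegrals from a partial trace -/

/-- The canonical tensor `∑ bᵢ ⊗ bᵢ*` is invariant under moving an endomorphism across it; this
is the cyclicity of the trace. -/
lemma Module.Basis.sum_apply_apply_coord {k V M ι : Type*} [Field k] [AddCommGroup V] [Module k V]
    [AddCommGroup M] [Module k M] [Fintype ι] (b : Module.Basis ι k V) (A : V →ₗ[k] V)
    (B : V →ₗ[k] (V →ₗ[k] k) →ₗ[k] M) :
    ∑ i, B (A (b i)) (b.coord i) = ∑ i, B (b i) (b.coord i ∘ₗ A) := by
  have h₁ : ∀ i, A (b i) = ∑ j, b.coord j (A (b i)) • b j := fun i => (b.sum_repr _).symm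
  have h₂ : ∀ j, b.coord j ∘ₗ A = ∑ i, b.coord j (A (b i)) • b.coord i := fun j => by
    refine b.ext fun i => ?_
    classical
    simp [Finsupp.single_apply]
  calc ∑ i, B (A (b i)) (b.coord i)
      = ∑ i, ∑ j, b.coord j (A (b i)) • B (b j) (b.coord i) := by
        refine Finset.sum_congr rfl fun i _ => ?_
        conv_lhs => rw [h₁ i]
        simp only [map_sum, map_smul, LinearMap.sum_apply, LinearMap.smul_apply]
    _ = ∑ j, B (b j) (b.coord j ∘ₗ A) := by
        rw [Finset.sum_comm]
        refine Finset.sum_congr rfl fun j _ => ?_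
        rw [h₂ j]
        simp only [map_sum, map_smul]

lemma Module.Basis.sum_coord_smul_apply {k V M ι : Type*} [Field k] [AddCommGroup V] [Module k V]
    [AddCommGroup M] [Module k M] [Fintype ι] (b : Module.Basis ι k V) (f : V →ₗ[k] M) (x : V) :
    ∑ i, b.coord i x • f (b i) = f x := by
  have h := congrArg f (b.sum_repr x)
  rw [map_sum] at h
  simpa using h

section Cointegral

open Coalgebra HopfAlgebra

variable {k H : Type u} [Field k] [Ring H] [HopfAlgebra k H]

lemma contractSnd_add (φ ψ : H →ₗ[k] k) (z : H ⊗[k] H) :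
    contractSnd (φ + ψ) z = contractSnd φ z + contractSnd ψ z := by
  simp [contractSnd, LinearMap.lTensor_add]

lemma contractSnd_smul (a : k) (φ : H →ₗ[k] k) (z : H ⊗[k] H) :
    contractSnd (a • φ) z = a • contractSnd φ z := by
  simp [contractSnd, LinearMap.lTensor_smul]

lemma contractFst_add (φ ψ : H →ₗ[k] k) (z : H ⊗[k] H) :
    contractFst (φ + ψ) z = contractFst φ z + contractFst ψ z := by
  simp [contractFst, LinearMap.rTensor_add]

lemma contractFst_smul (a : k) (φ : H →ₗ[k] k) (z : H ⊗[k] H) :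
    contractFst (a • φ) z = a • contractFst φ z := by
  simp [contractFst, LinearMap.rTensor_smul]

/-- The linear map `φ ↦ (φ ⊗ id)(z)`. -/
noncomputable def contractFstHom (z : H ⊗[k] H) : (H →ₗ[k] k) →ₗ[k] H where
  toFun φ := contractFst φ z
  map_add' φ ψ := contractFst_add φ ψ z
  map_smul' a φ := contractFst_smul a φ z

/-- The linear map `φ ↦ (id ⊗ φ)(z)`. -/
noncomputable def contractSndHom (z : H ⊗[k] H) : (H →ₗ[k] k) →ₗ[k] H where
  toFun φ := contractSnd φ z
  map_add' φ ψ := contractSnd_add φ ψ z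
  map_smul' a φ := contractSnd_smul a φ z

variable [FiniteDimensional k H] (g : Pivot k H)

/-- The partial trace of `a ↦ (1 ⊗ g) Δ(a) (1 ⊗ x)` over the second tensor factor. Its
values are left cointegrals. -/
noncomputable def cointegralTrace (x : H) : H :=
  ∑ i, contractSnd ((Module.finBasis k H).coord i)
    ((1 ⊗ₜ (g.val : H)) * comul (R := k) (Module.finBasis k H i) * (1 ⊗ₜ x))

/-- Writing `z ⊗ g = (1 ⊗ g S⁻¹(z₂)) Δ(z₁)` and moving `z₁` around the trace turns `z` into
`z₁ g S⁻¹(z₂) = z₁ S(z₂) g = ε(z) g`. -/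
lemma mul_cointegralTrace (x z : H) :
    z * cointegralTrace g x = counit (R := k) z • cointegralTrace g x := by
  let b := Module.finBasis k H
  let r := ℛ k z
  let B (s : H) : H →ₗ[k] (H →ₗ[k] k) →ₗ[k] H := LinearMap.mk₂ k
    (fun a φ => contractSnd φ ((1 ⊗ₜ s) * comul (R := k) a * (1 ⊗ₜ x)))
    (fun _ _ _ => by simp [mul_add, add_mul]) (fun _ _ _ => by simp)
    (fun _ _ _ => contractSnd_add _ _ _) (fun _ _ _ => contractSnd_smul _ _ _)
  have hB : ∀ s t, (∑ i, B s (t * b i) (b.coord i)) = ∑ i, B (t * s) (b i) (b.coord i) := by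
    intro s t
    refine (b.sum_apply_apply_coord (LinearMap.mulLeft k t) (B s)).trans ?_
    refine Finset.sum_congr rfl fun i _ => ?_
    simp only [B, LinearMap.mk₂_apply]
    have h := contractSnd_tmul_mul (b.coord i) ((1 ⊗ₜ s) * comul (R := k) (b i) * (1 ⊗ₜ x)) 1 t
    rw [one_mul] at h
    rw [← h, ← mul_assoc, ← mul_assoc]
    simp
  have hz : ∀ i, z * B g.val (b i) (b.coord i) =
      ∑ j ∈ r.index, B (g.val * g.antipodeInv (r.right j)) (r.left j * b i) (b.coord i) := by
    intro i
    have h := contractSnd_tmul_mul (b.coord i)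
      ((1 ⊗ₜ (g.val : H)) * comul (R := k) (b i) * (1 ⊗ₜ x)) z 1
    rw [mulLeft_one_eq_id, LinearMap.comp_id] at h
    simp only [B, LinearMap.mk₂_apply]
    rw [← h, ← mul_assoc, ← mul_assoc]
    have h' : (z ⊗ₜ[k] (1 : H)) * (1 ⊗ₜ (g.val : H)) = (1 ⊗ₜ (g.val : H)) * (z ⊗ₜ[k] (1 : H)) := by
      simp
    rw [h', ← g.sum_one_tmul_antipodeInv_mul_comul r, Finset.mul_sum, Finset.sum_mul,
      Finset.sum_mul, map_sum]
    refine Finset.sum_congr rfl fun j _ => ?_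
    rw [Bialgebra.comul_mul, ← mul_assoc, ← mul_assoc]
    simp
  have hE : cointegralTrace g x = ∑ i, B g.val (b i) (b.coord i) := rfl
  rw [hE, Finset.mul_sum]
  simp_rw [hz]
  rw [Finset.sum_comm]
  simp_rw [hB]
  rw [Finset.sum_comm, Finset.smul_sum]
  refine Finset.sum_congr rfl fun i _ => ?_
  simp only [B, LinearMap.mk₂_apply]
  rw [← map_sum, ← Finset.sum_mul, ← Finset.sum_mul, ← TensorProduct.tmul_sum]
  have hS : ∑ j ∈ r.index, r.left j * (g.val * g.antipodeInv (r.right j)) =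
      counit (R := k) z • (g.val : H) := by
    have h := sum_mul_antipode_eq_smul r
    calc _ = ∑ j ∈ r.index, (r.left j * antipode k (r.right j)) * g.val := by
          simp [Pivot.antipodeInv_apply, mul_assoc]
      _ = _ := by rw [← Finset.sum_mul, h, smul_mul_assoc, one_mul]
  rw [hS]
  simp

/-- The trace of `y ↦ cointegralTrace g (S⁻¹ y)` is `∑ bᵢ*(g bᵢ₂ S⁻¹(bᵢ₁)) = ε(g) = 1`. -/
lemma exists_cointegralTrace_ne_zero : ∃ x, cointegralTrace g x ≠ 0 := by
  by_contra! h
  let b := Module.finBasis k H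
  have h₁ : ∀ z : H ⊗[k] H, ∑ j, contractFst (b.coord j) z * g.antipodeInv (b j) =
      (LinearMap.mul' k H ∘ₗ (TensorProduct.comm k H H).toLinearMap ∘ₗ g.antipodeInv.rTensor H)
        z := by
    intro z
    induction z using TensorProduct.induction_on with
    | zero => simp
    | add z w hz hw => simp only [map_add, add_mul, Finset.sum_add_distrib, hz, hw]
    | tmul x y =>
      simpa using b.sum_coord_smul_apply (LinearMap.mulLeft k y ∘ₗ g.antipodeInv) x
  have h₂ : ∑ j, b.coord j (cointegralTrace g (g.antipodeInv (b j))) = 1 := by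
    calc _ = ∑ j, ∑ i, b.coord i (g.val * (contractFst (b.coord j) (comul (R := k) (b i)) *
            g.antipodeInv (b j))) := by
          refine Finset.sum_congr rfl fun j _ => ?_
          rw [cointegralTrace, map_sum]
          refine Finset.sum_congr rfl fun i _ => ?_
          rw [← apply_contractFst, contractFst_mul_tmul, contractFst_tmul_mul, mulRight_one_eq_id,
            mulLeft_one_eq_id, LinearMap.comp_id, LinearMap.comp_id, mul_assoc]
      _ = ∑ i, b.coord i (counit (R := k) (b i) • (g.val : H)) := by
          rw [Finset.sum_comm]
          refine Finset.sum_congr rfl fun i _ => ?_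
          rw [← map_sum, ← Finset.mul_sum, h₁, g.mul_antipodeInv_comul]
          simp
      _ = counit (R := k) (g.val : H) := by
          simpa [mul_comm] using b.sum_coord_smul_apply (counit (R := k)) (g.val : H)
      _ = 1 := g.isGroupLike.counit_eq_one
  simp [h] at h₂

/-- A unimodular Hopf algebra with a pivot has a non-zero two-sided cointegral. -/
lemma IsUnimodular.exists_cointegral (g : Pivot k H) (hH : IsUnimodular k H) :
    ∃ c : H, c ≠ 0 ∧ (∀ x, x * c = counit (R := k) x • c) ∧
      ∀ x, c * x = counit (R := k) x • c := by
  obtain ⟨x, hx⟩ := exists_cointegralTrace_ne_zero g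
  have hc : ∀ y, antipode k (cointegralTrace g x) * y =
      counit (R := k) y • antipode k (cointegralTrace g x) := by
    intro y
    obtain ⟨y, rfl⟩ := g.antipode_surjective y
    rw [← antipode_mul_antidistrib, mul_cointegralTrace, map_smul, counit_antipode]
  refine ⟨antipode k (cointegralTrace g x), fun h => hx (g.antipode_injective ?_), hH _ hc, hc⟩
  rw [h, map_zero]

end Cointegral

/-! ### Symmetrised integrals -/

section SymmetrizedIntegral

open Coalgebra HopfAlgebra

variable {k H : Type u} [Field k] [Ring H] [HopfAlgebra k H]

/-- `λ` is a symmetrised right integral if `(λ ⊗ id) Δ(x) = λ(x) g⁻¹`, that is, if `x ↦ λ(g⁻¹ x)` is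
a right integral. -/
def IsSymmetrizedRightIntegral (g : Pivot k H) (l : H →ₗ[k] k) : Prop :=
  ∀ x, contractFst l (comul (R := k) x) = l x • ((g.val⁻¹ : Hˣ) : H)

/-- `λ` is a symmetrised left integral if `(id ⊗ λ) Δ(x) = λ(x) g`, that is, if `x ↦ λ(g x)` is
a left integral. -/
def IsSymmetrizedLeftIntegral (g : Pivot k H) (l : H →ₗ[k] k) : Prop :=
  ∀ x, contractSnd l (comul (R := k) x) = l x • (g.val : H)

lemma isRightIntegral_comp_mulLeft_inv_iff (g : Pivot k H) (l : H →ₗ[k] k) :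
    IsRightIntegral (l ∘ₗ LinearMap.mulLeft k ((g.val⁻¹ : Hˣ) : H)) ↔
      IsSymmetrizedRightIntegral g l := by
  have key : ∀ x, contractFst l (comul (R := k) (((g.val⁻¹ : Hˣ) : H) * x)) =
      ((g.val⁻¹ : Hˣ) : H) *
        contractFst (l ∘ₗ LinearMap.mulLeft k ((g.val⁻¹ : Hˣ) : H)) (comul (R := k) x) := by
    intro x
    rw [Bialgebra.comul_mul, g.isGroupLikeElem_inv.comul_eq_tmul_self, contractFst_tmul_mul]
  constructor
  · intro h x
    have hx := key (g.val * x)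
    have h' := h (g.val * x)
    change contractFst _ _ = _ at h'
    rw [h'] at hx
    simpa [← mul_assoc] using hx
  · intro h x
    have hx := key x
    rw [h] at hx
    change contractFst _ _ = _
    have hx' := congrArg (fun y => (g.val : H) * y) hx
    simp only [← mul_assoc, Units.mul_inv, one_mul] at hx'
    rw [← hx']
    simp

lemma isLeftIntegral_comp_mulLeft_iff (g : Pivot k H) (l : H →ₗ[k] k) :
    IsLeftIntegral (l ∘ₗ LinearMap.mulLeft k (g.val : H)) ↔ IsSymmetrizedLeftIntegral g l := by
  have key : ∀ x, contractSnd l (comul (R := k) ((g.val : H) * x)) =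
      (g.val : H) * contractSnd (l ∘ₗ LinearMap.mulLeft k (g.val : H)) (comul (R := k) x) := by
    intro x
    rw [Bialgebra.comul_mul, g.isGroupLike.comul_eq_tmul_self, contractSnd_tmul_mul]
  constructor
  · intro h x
    have hx := key (((g.val⁻¹ : Hˣ) : H) * x)
    have h' := h (((g.val⁻¹ : Hˣ) : H) * x)
    change contractSnd _ _ = _ at h'
    rw [h'] at hx
    simpa [← mul_assoc] using hx
  · intro h x
    have hx := key x
    rw [h] at hx
    change contractSnd _ _ = _
    have hx' := congrArg (fun y => ((g.val⁻¹ : Hˣ) : H) * y) hx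
    simp only [← mul_assoc, Units.inv_mul, one_mul] at hx'
    rw [← hx']
    simp

section Cointegral

variable {c : H}

/-- For a left cointegral `c`, `c₁ ⊗ x c₂ = S(x) c₁ ⊗ c₂`. -/
lemma one_tmul_mul_comul_cointegral (hc : ∀ x, x * c = counit (R := k) x • c) (x : H) :
    (1 ⊗ₜ x) * comul (R := k) c = (antipode k x ⊗ₜ 1) * comul (R := k) c := by
  have h := sum_tmul_counit_eq (R := k) (ℛ k x)
  have h' := congrArg (LinearMap.rTensor k (antipode k (A := H))) h
  have h'' := congrArg (TensorProduct.rid k H) h'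
  simp only [map_sum, LinearMap.rTensor_tmul, TensorProduct.rid_tmul, one_smul] at h''
  rw [← sum_antipode_tmul_one_mul_comul (ℛ k x), Finset.sum_mul, ← h'', TensorProduct.sum_tmul,
    Finset.sum_mul]
  refine Finset.sum_congr rfl fun i _ => ?_
  rw [mul_assoc, ← Bialgebra.comul_mul, hc]
  simp [← TensorProduct.smul_tmul']

/-- For a right cointegral `c`, `c₁ x ⊗ c₂ = c₁ ⊗ c₂ S(x)`. -/
lemma comul_cointegral_mul_tmul_one (hc : ∀ x, c * x = counit (R := k) x • c) (x : H) :
    comul (R := k) c * (x ⊗ₜ 1) = comul (R := k) c * (1 ⊗ₜ antipode k x) := by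
  have h := sum_counit_tmul_eq (R := k) (ℛ k x)
  have h' := congrArg (LinearMap.lTensor k (antipode k (A := H))) h
  have h'' := congrArg (TensorProduct.lid k H) h'
  simp only [map_sum, LinearMap.lTensor_tmul, TensorProduct.lid_tmul, one_smul] at h''
  rw [← sum_comul_mul_one_tmul_antipode (ℛ k x), Finset.mul_sum, ← h'', TensorProduct.tmul_sum,
    Finset.mul_sum]
  refine Finset.sum_congr rfl fun i _ => ?_
  rw [← mul_assoc, ← Bialgebra.comul_mul, hc]
  simp [TensorProduct.tmul_smul]

variable [FiniteDimensional k H]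

/-- For a non-zero left cointegral `c`, the map `φ ↦ φ(c₁) c₂` is injective: if `φ(c₁) c₂ = 0`, then
`φ(y c₁) c₂ = 0` for all `y` because `c` is a cointegral, and inserting `S⁻¹(c₂)` for a part of `y`
gives `0 = φ(y S⁻¹(c₂) c₁) c₃ = φ(y) c`. -/
lemma contractFstHom_comul_cointegral_injective (g : Pivot k H) (hc₀ : c ≠ 0)
    (hc : ∀ x, x * c = counit (R := k) x • c) :
    Function.Injective (contractFstHom (comul (R := k) c)) := by
  rw [injective_iff_map_eq_zero]
  intro φ hφ
  change contractFst φ (comul (R := k) c) = 0 at hφ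
  have h₁ : ∀ y, contractFst (φ ∘ₗ LinearMap.mulLeft k y) (comul (R := k) c) = 0 := by
    intro y
    obtain ⟨x, rfl⟩ := g.antipode_surjective y
    have h := contractFst_tmul_mul φ (comul (R := k) c) (antipode k x) 1
    rw [one_mul] at h
    rw [← h, ← one_tmul_mul_comul_cointegral hc, contractFst_tmul_mul, mulLeft_one_eq_id,
      LinearMap.comp_id, hφ, mul_zero]
  let b := Module.finBasis k H
  ext y
  -- The product `S⁻¹(c₂) c₁` is not of the form covered by `h₁`; it is expanded as
  -- `∑ⱼ bⱼ*(c₂) S⁻¹(bⱼ) c₁`, and `h₁` applies to each `y S⁻¹(bⱼ)`.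
  let ψ (j) : H →ₗ[k] k := φ ∘ₗ LinearMap.mulLeft k (y * g.antipodeInv (b j))
  have h₂ : ∀ z : H ⊗[k] H, ∑ j, b.coord j (contractFst (ψ j) z) = φ (y *
      (LinearMap.mul' k H ∘ₗ (TensorProduct.comm k H H).toLinearMap ∘ₗ g.antipodeInv.lTensor H)
        z) := by
    intro z
    induction z using TensorProduct.induction_on with
    | zero => simp
    | add z w hz hw => simp only [map_add, mul_add, Finset.sum_add_distrib, hz, hw]
    | tmul a d =>
      simpa [ψ, mul_comm, mul_assoc] using b.sum_coord_smul_apply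
        (φ ∘ₗ LinearMap.mulLeft k y ∘ₗ LinearMap.mulRight k a ∘ₗ g.antipodeInv) d
  let r := ℛ k c
  have h₃ : ∀ j, ∑ i ∈ r.index,
      b.coord j (contractFst (ψ j) (comul (R := k) (r.left i))) • r.right i = 0 := by
    intro j
    have h := congrArg (contractFst (b.coord j)) (comul_contractFst_comul (ψ j) c)
    rw [h₁, map_zero, map_zero, ← r.eq] at h
    simpa using h.symm
  have h₄ : φ y • c = 0 := by
    have h := Finset.sum_eq_zero (s := Finset.univ) fun j _ => h₃ j
    rw [Finset.sum_comm] at h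
    simp_rw [← Finset.sum_smul, h₂, g.antipodeInv_mul_comul] at h
    rw [← h]
    conv_lhs => rw [← sum_counit_smul (R := k) r, Finset.smul_sum]
    refine Finset.sum_congr rfl fun i _ => ?_
    simp [smul_smul, mul_comm]
  simpa [hc₀] using h₄

lemma contractFstHom_comul_cointegral_bijective (g : Pivot k H) (hc₀ : c ≠ 0)
    (hc : ∀ x, x * c = counit (R := k) x • c) :
    Function.Bijective (contractFstHom (comul (R := k) c)) := by
  have h := contractFstHom_comul_cointegral_injective g hc₀ hc
  exact ⟨h, (LinearMap.injective_iff_surjective_of_finrank_eq_finrank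
    (Subspace.dual_finrank_eq (K := k) (V := H))).1 h⟩

/-- For a non-zero left cointegral `c`, the map `φ ↦ c₁ φ(c₂)` is bijective, being the transpose
of `φ ↦ φ(c₁) c₂`. -/
lemma contractSndHom_comul_cointegral_bijective (g : Pivot k H) (hc₀ : c ≠ 0)
    (hc : ∀ x, x * c = counit (R := k) x • c) :
    Function.Bijective (contractSndHom (comul (R := k) c)) := by
  have h : Function.Injective (contractSndHom (comul (R := k) c)) := by
    rw [injective_iff_map_eq_zero]
    intro φ hφ
    ext x
    obtain ⟨ψ, rfl⟩ := (contractFstHom_comul_cointegral_bijective g hc₀ hc).2 x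
    exact (apply_contractFst ψ φ _).trans ((congrArg ψ hφ).trans (map_zero ψ))
  exact ⟨h, (LinearMap.injective_iff_surjective_of_finrank_eq_finrank
    (Subspace.dual_finrank_eq (K := k) (V := H))).1 h⟩

end Cointegral

variable [FiniteDimensional k H]

/-- The symmetrised right integrals of a unimodular `H` are the multiples of a single form, which
is symmetric and non-degenerate. -/
lemma IsUnimodular.exists_symmetrizedRightIntegral (hH : IsUnimodular k H) (g : Pivot k H) :
    ∃ l : H →ₗ[k] k, IsSymmetrizedRightIntegral g l ∧
      (∀ l', IsSymmetrizedRightIntegral g l' → ∃ a : k, l' = a • l) ∧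
      (∀ x y, l (x * y) = l (y * x)) ∧ ∀ x, (∀ y, l (x * y) = 0) → x = 0 := by
  obtain ⟨c, hc₀, hl, hr⟩ := hH.exists_cointegral g
  have hβ := contractFstHom_comul_cointegral_bijective g hc₀ hl
  obtain ⟨l, hlg⟩ := hβ.2 ((g.val⁻¹ : Hˣ) : H)
  change contractFst l (comul (R := k) c) = _ at hlg
  -- By colinearity `l * ψ` and `ψ(g⁻¹) l` have the same image under `φ ↦ φ(c₁) c₂`, for all `ψ`.
  have hL : IsSymmetrizedRightIntegral g l := by
    intro x
    refine (Module.forall_dual_apply_eq_zero_iff k _).1 (fun ψ => ?_) |> sub_eq_zero.1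
    have h : ψ ∘ₗ contractFst l ∘ₗ comul = ψ ((g.val⁻¹ : Hˣ) : H) • l := by
      apply hβ.1
      have h₁ := congrArg (contractFst ψ) (comul_contractFst_comul l c)
      rw [hlg, g.isGroupLikeElem_inv.comul_eq_tmul_self, contractFst_tmul] at h₁
      rw [map_smul]
      change contractFst _ _ = _ • contractFst l _
      rw [hlg, h₁]
      simp only [contractFst, LinearMap.comp_apply, ← LinearMap.rTensor_comp_apply]
    have hx := LinearMap.congr_fun h x
    simp only [LinearMap.comp_apply, LinearMap.smul_apply, smul_eq_mul] at hx
    rw [map_sub, map_smul, hx, smul_eq_mul, mul_comm, sub_self]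
  have h₁ : ∀ x, contractFst (l ∘ₗ LinearMap.mulLeft k (antipode k x)) (comul (R := k) c) =
      x * ((g.val⁻¹ : Hˣ) : H) := by
    intro x
    have h := contractFst_tmul_mul l (comul (R := k) c) (antipode k x) 1
    rw [one_mul] at h
    rw [← h, ← one_tmul_mul_comul_cointegral hl, contractFst_tmul_mul, mulLeft_one_eq_id,
      LinearMap.comp_id, hlg]
  have h₂ : ∀ x, contractFst (l ∘ₗ LinearMap.mulRight k (antipode k x)) (comul (R := k) c) =
      x * ((g.val⁻¹ : Hˣ) : H) := by
    intro x
    have h := contractFst_mul_tmul l (comul (R := k) c) (antipode k x) 1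
    rw [mul_one] at h
    rw [← h, comul_cointegral_mul_tmul_one hr, contractFst_mul_tmul, mulRight_one_eq_id,
      LinearMap.comp_id, hlg, g.antipode_antipode]
    simp [← mul_assoc]
  refine ⟨l, hL, fun l' hl' => ⟨l' c, hβ.1 ?_⟩, fun x y => ?_, fun x hx => ?_⟩
  · rw [map_smul]
    change contractFst _ _ = _ • contractFst _ _
    rw [hl', hlg]
  · obtain ⟨x, rfl⟩ := g.antipode_surjective x
    exact LinearMap.congr_fun (hβ.1 ((h₁ x).trans (h₂ x).symm)) y
  · obtain ⟨x, rfl⟩ := g.antipode_surjective x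
    have h : l ∘ₗ LinearMap.mulLeft k (antipode k x) = 0 := LinearMap.ext hx
    have h' := h₁ x
    rw [h] at h'
    have h₀ : x * ((g.val⁻¹ : Hˣ) : H) = 0 := by rw [← h']; simp [contractFst]
    rw [(Units.mul_left_eq_zero _).1 h₀, map_zero]

/-- The symmetrised left integrals of a unimodular `H` are the multiples of a single form, which
is symmetric and non-degenerate. -/
lemma IsUnimodular.exists_symmetrizedLeftIntegral (hH : IsUnimodular k H) (g : Pivot k H) :
    ∃ l : H →ₗ[k] k, IsSymmetrizedLeftIntegral g l ∧
      (∀ l', IsSymmetrizedLeftIntegral g l' → ∃ a : k, l' = a • l) ∧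
      (∀ x y, l (x * y) = l (y * x)) ∧ ∀ x, (∀ y, l (x * y) = 0) → x = 0 := by
  obtain ⟨c, hc₀, hl, hr⟩ := hH.exists_cointegral g
  have hγ := contractSndHom_comul_cointegral_bijective g hc₀ hl
  obtain ⟨l, hlg⟩ := hγ.2 (g.val : H)
  change contractSnd l (comul (R := k) c) = _ at hlg
  have hL : IsSymmetrizedLeftIntegral g l := by
    intro x
    refine (Module.forall_dual_apply_eq_zero_iff k _).1 (fun ψ => ?_) |> sub_eq_zero.1
    have h : ψ ∘ₗ contractSnd l ∘ₗ comul = ψ (g.val : H) • l := by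
      apply hγ.1
      have h₁ := congrArg (contractSnd ψ) (comul_contractSnd_comul l c)
      rw [hlg, g.isGroupLike.comul_eq_tmul_self, contractSnd_tmul] at h₁
      rw [map_smul]
      change contractSnd _ _ = _ • contractSnd l _
      rw [hlg, h₁]
      simp only [contractSnd, LinearMap.comp_apply, ← LinearMap.lTensor_comp_apply]
    have hx := LinearMap.congr_fun h x
    simp only [LinearMap.comp_apply, LinearMap.smul_apply, smul_eq_mul] at hx
    rw [map_sub, map_smul, hx, smul_eq_mul, mul_comm, sub_self]
  have h₁ : ∀ x, contractSnd (l ∘ₗ LinearMap.mulLeft k x) (comul (R := k) c) =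
      antipode k x * (g.val : H) := by
    intro x
    have h := contractSnd_tmul_mul l (comul (R := k) c) 1 x
    rw [one_mul] at h
    rw [← h, one_tmul_mul_comul_cointegral hl, contractSnd_tmul_mul, mulLeft_one_eq_id,
      LinearMap.comp_id, hlg]
  have h₂ : ∀ x, contractSnd (l ∘ₗ LinearMap.mulRight k x) (comul (R := k) c) =
      antipode k x * (g.val : H) := by
    intro x
    have h := contractSnd_mul_tmul l (comul (R := k) c) 1 x
    rw [mul_one, ← g.antipode_antipodeInv x] at h
    rw [← comul_cointegral_mul_tmul_one hr, contractSnd_mul_tmul, mulRight_one_eq_id,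
      LinearMap.comp_id, hlg, g.antipode_antipodeInv, g.antipodeInv_apply] at h
    rw [← h]
    simp [← mul_assoc]
  refine ⟨l, hL, fun l' hl' => ⟨l' c, hγ.1 ?_⟩, fun x y => ?_, fun x hx => ?_⟩
  · rw [map_smul]
    change contractSnd _ _ = _ • contractSnd _ _
    rw [hl', hlg]
  · exact LinearMap.congr_fun (hγ.1 ((h₁ x).trans (h₂ x).symm)) y
  · have h : l ∘ₗ LinearMap.mulLeft k x = 0 := LinearMap.ext hx
    have h' := h₁ x
    rw [h] at h'
    have h₀ : antipode k x * (g.val : H) = 0 := by rw [← h']; simp [contractSnd]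
    exact g.antipode_injective (((Units.mul_left_eq_zero _).1 h₀).trans (map_zero _).symm)

end SymmetrizedIntegral

/-! ### Frames of projective modules and of tensor products -/

section Frame

open Coalgebra HopfAlgebra

variable {k H : Type u} [Field k] [Ring H] [HopfAlgebra k H]

namespace HopfRep

/-- A frame (finite dual basis) of an `H`-module `P`: vectors `eᵢ` and `H`-linear maps `pᵢ : P → H`
with `x = ∑ pᵢ(x) eᵢ`. The maps `pᵢ` are stored as `k`-linear maps commuting with `H`. -/
structure Frame (P : HopfRep k H) (ι : Type*) [Fintype ι] where
  vec : ι → P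
  coord : ι → P →ₗ[k] H
  coord_act : ∀ i h x, coord i (P.ρ h x) = h * coord i x
  sum_act : ∀ x, ∑ i, P.ρ (coord i x) (vec i) = x

lemma ρ_mul_apply (P : HopfRep k H) (x y : H) (v : P) : P.ρ (x * y) v = P.ρ x (P.ρ y v) := by
  rw [map_mul, Module.End.mul_apply]

lemma Hom.map_act {V W : HopfRep k H} (f : Hom V W) (h : H) (v : V) :
    f.1 (V.ρ h v) = W.ρ h (f.1 v) := f.2 h v

/-- The left regular module. -/
noncomputable abbrev regular (k H : Type u) [Field k] [Ring H] [HopfAlgebra k H]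
    [FiniteDimensional k H] : HopfRep k H where
  carrier := H
  ρ := Algebra.lmul k H

section Regular

variable [FiniteDimensional k H]

/-- The morphism `H → V`, `h ↦ h v`. -/
noncomputable def orbit (V : HopfRep k H) (v : V) : Hom (regular k H) V :=
  ⟨LinearMap.applyₗ v ∘ₗ V.ρ.toLinearMap, fun h x => V.ρ_mul_apply h x v⟩

@[simp]
lemma orbit_apply (V : HopfRep k H) (v : V) (h : H) : (V.orbit v).1 h = V.ρ h v := rfl

lemma regular_isProjective : (regular k H).IsProjective := by
  refine isProjective_of_split fun M p hp => ?_
  obtain ⟨m, hm⟩ := hp (1 : H)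
  exact ⟨M.orbit m, fun x => (p.2 x m).trans ((congrArg (fun y : H => x * y) hm).trans (mul_one x))⟩

lemma IsProjective.exists_frame {P : HopfRep k H} (hP : P.IsProjective) :
    Nonempty (P.Frame (Fin (Module.finrank k P))) := by
  let b := Module.finBasis k P
  let M : HopfRep k H :=
    { carrier := Fin (Module.finrank k P) → H, ρ := Algebra.lsmul k k (Fin _ → H) }
  let q : (Fin (Module.finrank k P) → H) →ₗ[k] P :=
    ∑ i, (LinearMap.applyₗ (b i) ∘ₗ P.ρ.toLinearMap) ∘ₗ LinearMap.proj i
  have hq : ∀ x, q x = ∑ i, P.ρ (x i) (b i) := fun x => by simp [q, LinearMap.sum_apply]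
  let p : Hom M P := ⟨q, fun h x => by
      change q (fun i => h * x i) = P.ρ h (q x)
      rw [hq, hq, map_sum]
      exact Finset.sum_congr rfl fun i _ => P.ρ_mul_apply h (x i) (b i)⟩
  have hp : Function.Surjective p.1 := fun x => by
    refine ⟨fun i => algebraMap k H (b.repr x i), (hq _).trans ?_⟩
    simp [Module.algebraMap_end_apply, b.sum_repr]
  obtain ⟨s, hs⟩ := hP.lift p hp (Hom.id P)
  refine ⟨⟨b, fun i => LinearMap.proj i ∘ₗ s.1, fun i h x => ?_, fun x => ?_⟩⟩
  · exact congrFun (s.2 h x) i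
  · exact (hq _).symm.trans (LinearMap.congr_fun (congrArg Subtype.val hs) x)

end Regular

namespace Frame

variable {ι κ : Type*} [Fintype ι] [Fintype κ]

/-- The trace `∑ l(pᵢ(f(eᵢ)))` of an endomorphism `f` attached to a linear form `l` on `H`, computed
in a frame. -/
noncomputable def trace {P : HopfRep k H} (F : P.Frame ι) (l : H →ₗ[k] k) : Hom P P →ₗ[k] k :=
  ∑ i, (l ∘ₗ F.coord i ∘ₗ LinearMap.applyₗ (F.vec i)) ∘ₗ (Hom P P).subtype

lemma trace_apply {P : HopfRep k H} (F : P.Frame ι) (l : H →ₗ[k] k) (f : Hom P P) :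
    F.trace l f = ∑ i, l (F.coord i (f.1 (F.vec i))) := by
  simp [trace]

lemma trace_comp_comm {V W : HopfRep k H} (F : V.Frame ι) (G : W.Frame κ) {l : H →ₗ[k] k}
    (hl : ∀ x y, l (x * y) = l (y * x)) (a : Hom V W) (b : Hom W V) :
    F.trace l (Hom.comp b a) = G.trace l (Hom.comp a b) := by
  rw [trace_apply, trace_apply]
  have h₁ : ∀ i, l (F.coord i ((Hom.comp b a).1 (F.vec i))) =
      ∑ j, l (G.coord j (a.1 (F.vec i)) * F.coord i (b.1 (G.vec j))) := fun i => by
    change l (F.coord i (b.1 (a.1 (F.vec i)))) = _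
    conv_lhs => rw [← G.sum_act (a.1 (F.vec i))]
    simp only [map_sum, Hom.map_act, F.coord_act]
  have h₂ : ∀ j, l (G.coord j ((Hom.comp a b).1 (G.vec j))) =
      ∑ i, l (F.coord i (b.1 (G.vec j)) * G.coord j (a.1 (F.vec i))) := fun j => by
    change l (G.coord j (a.1 (b.1 (G.vec j)))) = _
    conv_lhs => rw [← F.sum_act (b.1 (G.vec j))]
    simp only [map_sum, Hom.map_act, G.coord_act]
  simp_rw [h₁, h₂]
  rw [Finset.sum_comm]
  simp_rw [hl (G.coord _ _)]

lemma trace_eq_trace {V : HopfRep k H} (F : V.Frame ι) (G : V.Frame κ) {l : H →ₗ[k] k}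
    (hl : ∀ x y, l (x * y) = l (y * x)) (f : Hom V V) : F.trace l f = G.trace l f :=
  F.trace_comp_comm G hl f (Hom.id V)

variable [FiniteDimensional k H]

/-- The coordinate map `pᵢ` as a morphism of modules. -/
noncomputable def coordHom {V : HopfRep k H} (F : V.Frame ι) (i : ι) : Hom V (regular k H) :=
  ⟨F.coord i, F.coord_act i⟩

/-- The frame `(1, id)` of the regular module. -/
noncomputable def regular : (regular k H).Frame Unit where
  vec _ := (1 : H)
  coord _ := LinearMap.id
  coord_act _ _ _ := rfl
  sum_act x := by simp

end Frame

/-- The matrix coefficient `h ↦ f(h v)`. -/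
noncomputable def matrixCoeff (V : HopfRep k H) (f : Module.Dual k V) (v : V) : H →ₗ[k] k :=
  f ∘ₗ LinearMap.applyₗ v ∘ₗ V.ρ.toLinearMap

@[simp]
lemma matrixCoeff_apply (V : HopfRep k H) (f : Module.Dual k V) (v : V) (h : H) :
    V.matrixCoeff f v h = f (V.ρ h v) := rfl

lemma matrixCoeff_add (V : HopfRep k H) (f : Module.Dual k V) (v w : V) :
    V.matrixCoeff f (v + w) = V.matrixCoeff f v + V.matrixCoeff f w := by
  ext; simp

lemma matrixCoeff_smul (V : HopfRep k H) (f : Module.Dual k V) (c : k) (v : V) :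
    V.matrixCoeff f (c • v) = c • V.matrixCoeff f v := by
  ext; simp

lemma act₂_comul_tmul (V W : HopfRep k H) {h : H} {ι : Type*} (r : Coalgebra.Repr k h ι)
    (v : V) (w : W) :
    (V.tensor W).ρ h (v ⊗ₜ w) = ∑ i ∈ r.index, V.ρ (r.left i) v ⊗ₜ W.ρ (r.right i) w := by
  rw [tensor_ρ, ← r.eq]
  simp [act₂_tmul]

section TensorFrame

variable (g : Pivot k H)

/-- For a morphism `p : U → H` and `f ∈ V*`, the map `U ⊗ V → H`,
`u ⊗ v ↦ p(u)₁ f(S(p(u)₂) v)`. It is `H`-linear. -/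
noncomputable def tensorCoordRight {U : HopfRep k H} (p : U →ₗ[k] H) (V : HopfRep k H)
    (f : Module.Dual k V) : U ⊗[k] V →ₗ[k] H :=
  TensorProduct.lift (LinearMap.mk₂ k
    (fun u v => contractSnd (V.matrixCoeff f v ∘ₗ antipode k) (comul (R := k) (p u)))
    (fun _ _ _ => by simp) (fun _ _ _ => by simp)
    (fun _ _ _ => by rw [matrixCoeff_add, LinearMap.add_comp, contractSnd_add])
    (fun _ _ _ => by rw [matrixCoeff_smul, LinearMap.smul_comp, contractSnd_smul]))

@[simp]
lemma tensorCoordRight_tmul {U : HopfRep k H} (p : U →ₗ[k] H) (V : HopfRep k H)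
    (f : Module.Dual k V) (u : U) (v : V) : tensorCoordRight p V f (u ⊗ₜ v) =
      contractSnd (V.matrixCoeff f v ∘ₗ antipode k) (comul (R := k) (p u)) := rfl

/-- For a morphism `p : V → H` and `f ∈ U*`, the map `U ⊗ V → H`,
`u ⊗ v ↦ f(S⁻¹(p(v)₁) u) p(v)₂`. It is `H`-linear. -/
noncomputable def tensorCoordLeft (U : HopfRep k H) {V : HopfRep k H} (p : V →ₗ[k] H)
    (f : Module.Dual k U) : U ⊗[k] V →ₗ[k] H :=
  TensorProduct.lift (LinearMap.mk₂ k
    (fun u v => contractFst (U.matrixCoeff f u ∘ₗ g.antipodeInv) (comul (R := k) (p v)))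
    (fun _ _ _ => by rw [matrixCoeff_add, LinearMap.add_comp, contractFst_add])
    (fun _ _ _ => by rw [matrixCoeff_smul, LinearMap.smul_comp, contractFst_smul])
    (fun _ _ _ => by simp) (fun _ _ _ => by simp))

@[simp]
lemma tensorCoordLeft_tmul (U : HopfRep k H) {V : HopfRep k H} (p : V →ₗ[k] H)
    (f : Module.Dual k U) (u : U) (v : V) : tensorCoordLeft g U p f (u ⊗ₜ v) =
      contractFst (U.matrixCoeff f u ∘ₗ g.antipodeInv) (comul (R := k) (p v)) := rfl

lemma tensorCoordRight_act (g : Pivot k H) {U : HopfRep k H} {p : U →ₗ[k] H}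
    (hp : ∀ h x, p (U.ρ h x) = h * p x) (V : HopfRep k H) (f : Module.Dual k V) (h : H)
    (x : U ⊗[k] V) :
    tensorCoordRight p V f ((U.tensor V).ρ h x) = h * tensorCoordRight p V f x := by
  induction x using TensorProduct.induction_on with
  | zero => simp
  | add x y hx hy => simp only [map_add, mul_add, hx, hy]
  | tmul u v =>
    have h₁ : ∀ s : H, V.matrixCoeff f (V.ρ s v) ∘ₗ antipode k =
        (V.matrixCoeff f v ∘ₗ antipode k) ∘ₗ LinearMap.mulLeft k (g.antipodeInv s) := fun s => by
      ext b
      simp [antipode_mul_antidistrib]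
    let r := ℛ k h
    rw [act₂_comul_tmul U V r, map_sum]
    have h₂ := contractSnd_tmul_mul (V.matrixCoeff f v ∘ₗ antipode k) (comul (R := k) (p u)) h 1
    rw [mulLeft_one_eq_id, LinearMap.comp_id] at h₂
    rw [tensorCoordRight_tmul, ← h₂, ← g.sum_one_tmul_antipodeInv_mul_comul r, Finset.sum_mul,
      map_sum]
    refine Finset.sum_congr rfl fun i _ => ?_
    rw [tensorCoordRight_tmul, h₁, hp, Bialgebra.comul_mul, mul_assoc, contractSnd_tmul_mul,
      one_mul]

lemma tensorCoordLeft_act (U : HopfRep k H) {V : HopfRep k H} {p : V →ₗ[k] H}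
    (hp : ∀ h x, p (V.ρ h x) = h * p x) (f : Module.Dual k U) (h : H) (x : U ⊗[k] V) :
    tensorCoordLeft g U p f ((U.tensor V).ρ h x) = h * tensorCoordLeft g U p f x := by
  induction x using TensorProduct.induction_on with
  | zero => simp
  | add x y hx hy => simp only [map_add, mul_add, hx, hy]
  | tmul u v =>
    have h₁ : ∀ s : H, U.matrixCoeff f (U.ρ s u) ∘ₗ g.antipodeInv =
        (U.matrixCoeff f u ∘ₗ g.antipodeInv) ∘ₗ LinearMap.mulLeft k (antipode k s) := fun s => by
      ext b
      have hb : g.antipodeInv b * s = g.antipodeInv (antipode k s * b) := by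
        apply g.antipode_injective
        simp [antipode_mul_antidistrib]
      simp [← ρ_mul_apply, hb]
    let r := ℛ k h
    rw [act₂_comul_tmul U V r, map_sum]
    have h₂ := contractFst_tmul_mul (U.matrixCoeff f u ∘ₗ g.antipodeInv) (comul (R := k) (p v)) 1 h
    rw [mulLeft_one_eq_id, LinearMap.comp_id] at h₂
    rw [tensorCoordLeft_tmul, ← h₂, ← sum_antipode_tmul_one_mul_comul r, Finset.sum_mul,
      map_sum]
    refine Finset.sum_congr rfl fun i _ => ?_
    rw [tensorCoordLeft_tmul, h₁, hp, Bialgebra.comul_mul, mul_assoc, contractFst_tmul_mul,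
      one_mul]

lemma tensor_act_eq (U V : HopfRep k H) (h : H) (x : U ⊗[k] V) (s : H ⊗[k] H) :
    (U.tensor V).ρ h (U.act₂ V s x) = U.act₂ V (comul (R := k) h * s) x := by
  rw [tensor_ρ, map_mul, Module.End.mul_apply]

/-- `∑ⱼ vⱼ*(S(y₂) v) Δ(y₁)(e ⊗ vⱼ) = Δ(y₁) (1 ⊗ S(y₂)) (e ⊗ v) = y e ⊗ v`. -/
lemma sum_tensor_act_contractSnd {U V : HopfRep k H} {κ : Type*} [Fintype κ]
    (b : Module.Basis κ k V) (y : H) (e : U) (v : V) :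
    ∑ j, (U.tensor V).ρ (contractSnd (V.matrixCoeff (b.coord j) v ∘ₗ antipode k)
      (comul (R := k) y)) (e ⊗ₜ b j) = U.ρ y e ⊗ₜ v := by
  have h₁ : ∀ a d : H, ∑ j, (U.tensor V).ρ
      (contractSnd (V.matrixCoeff (b.coord j) v ∘ₗ antipode k) (a ⊗ₜ d)) (e ⊗ₜ b j) =
      U.act₂ V (comul (R := k) a * (1 ⊗ₜ antipode k d)) (e ⊗ₜ v) := by
    intro a d
    have h := b.sum_coord_smul_apply ((U.tensor V).ρ a ∘ₗ TensorProduct.mk k U V e)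
      (V.ρ (antipode k d) v)
    rw [← tensor_act_eq, act₂_tmul]
    simpa using h
  let r := ℛ k y
  rw [← r.eq]
  simp only [map_sum, LinearMap.sum_apply]
  rw [Finset.sum_comm]
  simp_rw [h₁]
  rw [← LinearMap.sum_apply, ← map_sum, sum_comul_mul_one_tmul_antipode r, act₂_tmul]
  simp

/-- `∑ⱼ uⱼ*(S⁻¹(y₁) u) Δ(y₂)(uⱼ ⊗ e) = Δ(y₂) (S⁻¹(y₁) ⊗ 1) (u ⊗ e) = u ⊗ y e`. -/
lemma sum_tensor_act_contractFst {U V : HopfRep k H} {κ : Type*} [Fintype κ]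
    (b : Module.Basis κ k U) (y : H) (e : V) (u : U) :
    ∑ j, (U.tensor V).ρ (contractFst (U.matrixCoeff (b.coord j) u ∘ₗ g.antipodeInv)
      (comul (R := k) y)) (b j ⊗ₜ e) = u ⊗ₜ V.ρ y e := by
  have h₁ : ∀ a d : H, ∑ j, (U.tensor V).ρ
      (contractFst (U.matrixCoeff (b.coord j) u ∘ₗ g.antipodeInv) (a ⊗ₜ d)) (b j ⊗ₜ e) =
      U.act₂ V (comul (R := k) d * (g.antipodeInv a ⊗ₜ 1)) (u ⊗ₜ e) := by
    intro a d
    have h := b.sum_coord_smul_apply ((U.tensor V).ρ d ∘ₗ (TensorProduct.mk k U V).flip e)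
      (U.ρ (g.antipodeInv a) u)
    rw [← tensor_act_eq, act₂_tmul]
    simpa using h
  let r := ℛ k y
  rw [← r.eq]
  simp only [map_sum, LinearMap.sum_apply]
  rw [Finset.sum_comm]
  simp_rw [h₁]
  rw [← LinearMap.sum_apply, ← map_sum, g.sum_comul_mul_antipodeInv_tmul_one r, act₂_tmul]
  simp

/-- A frame of `U` and a basis `(vⱼ)` of `V` give a frame of `U ⊗ V` with vectors `eᵢ ⊗ vⱼ`. -/
noncomputable def Frame.tensorRight {U : HopfRep k H} {ι κ : Type*} [Fintype ι] [Fintype κ]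
    (F : U.Frame ι) {V : HopfRep k H} (b : Module.Basis κ k V) :
    (U.tensor V).Frame (ι × κ) where
  vec i := F.vec i.1 ⊗ₜ b i.2
  coord i := tensorCoordRight (F.coord i.1) V (b.coord i.2)
  coord_act i := tensorCoordRight_act g (F.coord_act i.1) V (b.coord i.2)
  sum_act x := by
    rw [Fintype.sum_prod_type]
    induction x using TensorProduct.induction_on with
    | zero => simp
    | add x y hx hy =>
      simp only [map_add, LinearMap.add_apply, Finset.sum_add_distrib, hx, hy]
    | tmul u v =>
      simp_rw [tensorCoordRight_tmul]
      refine (Finset.sum_congr rfl fun i _ => sum_tensor_act_contractSnd b _ _ _).trans ?_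
      rw [← TensorProduct.sum_tmul, F.sum_act]

/-- A frame of `V` and a basis `(uⱼ)` of `U` give a frame of `U ⊗ V` with vectors `uⱼ ⊗ eᵢ`. -/
noncomputable def Frame.tensorLeft {V : HopfRep k H} {ι κ : Type*} [Fintype ι] [Fintype κ]
    (F : V.Frame ι) {U : HopfRep k H} (b : Module.Basis κ k U) :
    (U.tensor V).Frame (ι × κ) where
  vec i := b i.2 ⊗ₜ F.vec i.1
  coord i := tensorCoordLeft g U (F.coord i.1) (b.coord i.2)
  coord_act i := tensorCoordLeft_act g U (F.coord_act i.1) (b.coord i.2)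
  sum_act x := by
    rw [Fintype.sum_prod_type]
    induction x using TensorProduct.induction_on with
    | zero => simp
    | add x y hx hy =>
      simp only [map_add, LinearMap.add_apply, Finset.sum_add_distrib, hx, hy]
    | tmul u v =>
      simp_rw [tensorCoordLeft_tmul]
      refine (Finset.sum_congr rfl fun i _ => sum_tensor_act_contractFst g b _ _ _).trans ?_
      rw [← TensorProduct.tmul_sum, F.sum_act]

end TensorFrame

end HopfRep

end Frame

/-! ### Trace families attached to linear forms -/

section Trace

open Coalgebra HopfAlgebra

variable {k H : Type u} [Field k] [Ring H] [HopfAlgebra k H]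

namespace HopfRep

lemma cupRight_apply {U V W : HopfRep k H} (a : Hom (U.tensor V) W) (u : U) :
    (cupRight a).1 u = ∑ j, a.1 (u ⊗ₜ Module.Basis.ofVectorSpace k V j) ⊗ₜ[k]
      (Module.Basis.ofVectorSpace k V).coord j := by
  change TensorProduct.map a.1 LinearMap.id ((TensorProduct.assoc k U V (Module.Dual k V)).symm
    (TensorProduct.map LinearMap.id (coevaluation k V) ((TensorProduct.rid k U).symm u))) = _
  simp [coevaluation_apply_one, TensorProduct.tmul_sum]

lemma capRight_tmul (g : Pivot k H) {U V W : HopfRep k H} (b : Hom W (U.tensor V)) (w : W)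
    (f : Module.Dual k V) : (capRight g b).1 (w ⊗ₜ f) =
      TensorProduct.rid k U ((f ∘ₗ V.ρ (g.val : H)).lTensor U (b.1 w)) := by
  change TensorProduct.rid k U (TensorProduct.map LinearMap.id
    (contractRight k V ∘ₗ (V.ρ (g.val : H)).rTensor (Module.Dual k V))
    (TensorProduct.assoc k U V (Module.Dual k V) (b.1 w ⊗ₜ f))) = _
  generalize b.1 w = z
  induction z using TensorProduct.induction_on with
  | zero => simp
  | add z z' hz hz' => simp only [TensorProduct.add_tmul, map_add, hz, hz']
  | tmul u v => simp

/-- The right partial trace of `b ∘ a`. -/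
lemma capRight_comp_cupRight_apply (g : Pivot k H) {U V W : HopfRep k H}
    (a : Hom (U.tensor V) W) (b : Hom W (U.tensor V)) (u : U) :
    (Hom.comp (capRight g b) (cupRight a)).1 u =
      ∑ j, TensorProduct.rid k U
        (((Module.Basis.ofVectorSpace k V).coord j ∘ₗ V.ρ (g.val : H)).lTensor U
          (b.1 (a.1 (u ⊗ₜ Module.Basis.ofVectorSpace k V j)))) := by
  change (capRight g b).1 ((cupRight a).1 u) = _
  rw [cupRight_apply, map_sum]
  exact Finset.sum_congr rfl fun j _ => capRight_tmul g b _ _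

lemma cupLeft_apply (g : Pivot k H) {U V W : HopfRep k H} (a : Hom (U.tensor V) W) (v : V) :
    (cupLeft g a).1 v = ∑ j, (Module.Basis.ofVectorSpace k U).coord j ⊗ₜ[k]
      a.1 (U.ρ ((g.val⁻¹ : Hˣ) : H) (Module.Basis.ofVectorSpace k U j) ⊗ₜ v) := by
  change TensorProduct.map LinearMap.id a.1 (TensorProduct.assoc k (Module.Dual k U) U V
    (TensorProduct.map ((U.ρ ((g.val⁻¹ : Hˣ) : H)).lTensor (Module.Dual k U) ∘ₗ
      (TensorProduct.comm k U (Module.Dual k U)).toLinearMap ∘ₗ coevaluation k U) LinearMap.id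
      ((TensorProduct.lid k V).symm v))) = _
  simp [coevaluation_apply_one, TensorProduct.sum_tmul]

lemma capLeft_tmul {U V W : HopfRep k H} (b : Hom W (U.tensor V)) (f : Module.Dual k U) (w : W) :
    (capLeft b).1 (f ⊗ₜ w) = TensorProduct.lid k V (f.rTensor V (b.1 w)) := by
  change TensorProduct.lid k V (TensorProduct.map (contractLeft k U) LinearMap.id
    ((TensorProduct.assoc k (Module.Dual k U) U V).symm (f ⊗ₜ b.1 w))) = _
  generalize b.1 w = z
  induction z using TensorProduct.induction_on with
  | zero => simp
  | add z z' hz hz' => simp only [TensorProduct.tmul_add, map_add, hz, hz']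
  | tmul u v => simp

/-- The left partial trace of `b ∘ a`. Cyclicity moves `g⁻¹` from the vectors of the basis of `U` to
the dual basis. -/
lemma capLeft_comp_cupLeft_apply (g : Pivot k H) {U V W : HopfRep k H}
    (a : Hom (U.tensor V) W) (b : Hom W (U.tensor V)) (v : V) :
    (Hom.comp (capLeft b) (cupLeft g a)).1 v =
      ∑ j, TensorProduct.lid k V
        (((Module.Basis.ofVectorSpace k U).coord j ∘ₗ U.ρ ((g.val⁻¹ : Hˣ) : H)).rTensor V
          (b.1 (a.1 (Module.Basis.ofVectorSpace k U j ⊗ₜ v)))) := by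
  change (capLeft b).1 ((cupLeft g a).1 v) = _
  rw [cupLeft_apply, map_sum]
  let B : U →ₗ[k] (U →ₗ[k] k) →ₗ[k] V := LinearMap.mk₂ k
    (fun u f => TensorProduct.lid k V (f.rTensor V (b.1 (a.1 (u ⊗ₜ v)))))
    (fun _ _ _ => by simp only [TensorProduct.add_tmul, map_add])
    (fun _ _ _ => by simp only [← TensorProduct.smul_tmul', map_smul])
    (fun _ _ _ => by simp only [LinearMap.rTensor_add, LinearMap.add_apply, map_add])
    (fun _ _ _ => by simp only [LinearMap.rTensor_smul, LinearMap.smul_apply, map_smul])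
  have h := (Module.Basis.ofVectorSpace k U).sum_apply_apply_coord (U.ρ ((g.val⁻¹ : Hˣ) : H)) B
  refine Eq.trans (Finset.sum_congr rfl fun j _ => ?_) h
  exact capLeft_tmul b _ _

/-- The term-by-term comparison of the trace of an endomorphism of `U ⊗ V` with the trace of its right
partial trace. -/
lemma apply_tensorCoordRight {g : Pivot k H} {l : H →ₗ[k] k} (hl : IsSymmetrizedRightIntegral g l)
    {U V : HopfRep k H} (p : U →ₗ[k] H) (f : Module.Dual k V) (x : U ⊗[k] V) :
    l (tensorCoordRight p V f x) =
      l (p (TensorProduct.rid k U ((f ∘ₗ V.ρ (g.val : H)).lTensor U x))) := by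
  induction x using TensorProduct.induction_on with
  | zero => simp
  | add x y hx hy => simp only [map_add, hx, hy]
  | tmul u v =>
    rw [tensorCoordRight_tmul, ← apply_contractFst, hl]
    simp [g.antipode_inv, mul_comm]

/-- The term-by-term comparison of the trace of an endomorphism of `U ⊗ V` with the trace of its left
partial trace. -/
lemma apply_tensorCoordLeft {g : Pivot k H} {l : H →ₗ[k] k} (hl : IsSymmetrizedLeftIntegral g l)
    {U V : HopfRep k H} (p : V →ₗ[k] H) (f : Module.Dual k U) (x : U ⊗[k] V) :
    l (tensorCoordLeft g U p f x) =
      l (p (TensorProduct.lid k V ((f ∘ₗ U.ρ ((g.val⁻¹ : Hˣ) : H)).rTensor V x))) := by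
  have hg : g.antipodeInv (g.val : H) = ((g.val⁻¹ : Hˣ) : H) := by
    rw [← g.antipode_inv, g.antipodeInv_antipode]
  induction x using TensorProduct.induction_on with
  | zero => simp
  | add x y hx hy => simp only [map_add, hx, hy]
  | tmul u v =>
    rw [tensorCoordLeft_tmul, apply_contractFst, hl]
    simp [hg, mul_comm]

end HopfRep

namespace HopfProj

variable [FiniteDimensional k H]

/-- The regular module as an object of `H`-pmod. -/
noncomputable abbrev regular (k H : Type u) [Field k] [Ring H] [HopfAlgebra k H]
    [FiniteDimensional k H] : HopfProj k H :=
  ⟨HopfRep.regular k H, HopfRep.regular_isProjective⟩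

/-- A chosen frame of a projective module. -/
noncomputable def frame (P : HopfProj k H) : P.obj.Frame (Fin (Module.finrank k P.obj)) :=
  P.isProjective.exists_frame.some

end HopfProj

namespace TraceFamily

open HopfRep

variable [FiniteDimensional k H]

/-- The family of traces attached to a linear form on `H`. -/
noncomputable def ofForm (l : H →ₗ[k] k) : TraceFamily k H := fun P => P.frame.trace l

/-- The linear form on `H` attached to a family `t`: the values of `t` on the right multiplications
of the regular module. -/
noncomputable def form (t : TraceFamily k H) : H →ₗ[k] k where
  toFun x := t (HopfProj.regular k H) ((HopfRep.regular k H).orbit x)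
  map_add' x y := by
    rw [← map_add]
    congr 1
    exact Subtype.ext (LinearMap.ext fun h => mul_add h x y)
  map_smul' c x := by
    rw [← map_smul]
    congr 1
    exact Subtype.ext (LinearMap.ext fun h => mul_smul_comm c h x)

lemma ofForm_apply {l : H →ₗ[k] k} (hl : ∀ x y, l (x * y) = l (y * x)) (P : HopfProj k H)
    {ι : Type*} [Fintype ι] (F : P.obj.Frame ι) (f : HopfProj.Hom P P) :
    ofForm l P f = F.trace l f :=
  Frame.trace_eq_trace _ F hl f

lemma ofForm_smul (c : k) (l : H →ₗ[k] k) : ofForm (c • l) = c • ofForm l := by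
  funext P
  ext f
  simp [ofForm, Frame.trace_apply, Finset.mul_sum]

lemma form_ofForm {l : H →ₗ[k] k} (hl : ∀ x y, l (x * y) = l (y * x)) :
    (ofForm l).form = l := by
  ext x
  refine (ofForm_apply hl (HopfProj.regular k H) Frame.regular _).trans ?_
  rw [Frame.trace_apply]
  change ∑ _i : Unit, l (1 * x) = l x
  simp

/-- A cyclic family is determined by its values on the regular module: an endomorphism of `P` is the
sum of its compositions with the projections `x ↦ pᵢ(x) eᵢ`, which factor through `H`. -/
lemma ofForm_form {t : TraceFamily k H} (ht : t.IsCalabiYau) : ofForm t.form = t := by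
  funext P
  ext f
  let F := P.frame
  have h₁ : f = ∑ i, Hom.comp (Hom.comp f (P.obj.orbit (F.vec i))) (F.coordHom i) := by
    refine Subtype.ext (LinearMap.ext fun x => ?_)
    have h := congrArg f.1 (F.sum_act x)
    rw [map_sum] at h
    rw [← h, Submodule.coe_sum, LinearMap.sum_apply]
    rfl
  have h₂ : ∀ i, t P (Hom.comp (Hom.comp f (P.obj.orbit (F.vec i))) (F.coordHom i)) =
      t.form (F.coord i (f.1 (F.vec i))) := by
    intro i
    refine (ht.cyclic (V := P) (W := HopfProj.regular k H) (F.coordHom i)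
      (Hom.comp f (P.obj.orbit (F.vec i)))).trans ?_
    refine congrArg (t (HopfProj.regular k H)) (Subtype.ext (LinearMap.ext fun h => ?_))
    change F.coord i (f.1 (P.obj.ρ h (F.vec i))) = (h : H) * F.coord i (f.1 (F.vec i))
    rw [Hom.map_act, F.coord_act]
  conv_rhs => rw [h₁, map_sum]
  simp_rw [h₂]
  exact F.trace_apply _ _

lemma isCalabiYau_ofForm {l : H →ₗ[k] k} (hl : ∀ x y, l (x * y) = l (y * x))
    (hn : ∀ x, (∀ y, l (x * y) = 0) → x = 0) : (ofForm l).IsCalabiYau := by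
  have hc : ∀ {V W : HopfProj k H} (f : HopfProj.Hom V W) (g : HopfProj.Hom W V),
      ofForm l V (Hom.comp g f) = ofForm l W (Hom.comp f g) :=
    fun f g => Frame.trace_comp_comm _ _ hl f g
  have hnl : ∀ {V W : HopfProj k H} (f : HopfProj.Hom V W),
      (∀ g : HopfProj.Hom W V, ofForm l W (Hom.comp f g) = 0) → f = 0 := by
    intro V W f hf
    have h₁ : ∀ i j, W.frame.coord j (f.1 (V.frame.vec i)) = 0 := by
      intro i j
      refine hn _ fun y => ?_
      -- The form is tested on the composite `W → H → V` of `qⱼ` with `h ↦ h y eᵢ`.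
      have h := hf (Hom.comp (V.obj.orbit (V.obj.ρ y (V.frame.vec i))) (W.frame.coordHom j))
      have h' := (hc (V := W) (W := HopfProj.regular k H) (W.frame.coordHom j)
        (Hom.comp f (V.obj.orbit (V.obj.ρ y (V.frame.vec i))))).symm.trans h
      rw [ofForm_apply hl _ Frame.regular, Frame.trace_apply] at h'
      change ∑ _i : Unit, l (W.frame.coord j (f.1 (V.obj.ρ 1 (V.obj.ρ y (V.frame.vec i))))) = 0 at h'
      rw [map_one, Module.End.one_apply, Hom.map_act, W.frame.coord_act] at h'
      rw [hl]
      simpa using h'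
    refine Subtype.ext (LinearMap.ext fun x => ?_)
    rw [← V.frame.sum_act x, map_sum]
    refine Finset.sum_eq_zero fun i _ => ?_
    rw [Hom.map_act, ← W.frame.sum_act (f.1 (V.frame.vec i))]
    simp [h₁]
  exact ⟨hc, hnl, fun {V W} g hg => hnl g fun f => (hc g f).symm.trans (hg f)⟩

lemma form_symm {t : TraceFamily k H} (ht : t.IsCalabiYau) (x y : H) :
    t.form (x * y) = t.form (y * x) := by
  have h : ∀ x y : H, (HopfRep.regular k H).orbit (x * y) =
      Hom.comp ((HopfRep.regular k H).orbit y) ((HopfRep.regular k H).orbit x) := fun x y =>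
    Subtype.ext (LinearMap.ext fun h => (mul_assoc h x y).symm)
  change t (HopfProj.regular k H) ((HopfRep.regular k H).orbit (x * y)) =
    t (HopfProj.regular k H) ((HopfRep.regular k H).orbit (y * x))
  rw [h, h]
  exact ht.cyclic (V := HopfProj.regular k H) (W := HopfProj.regular k H) _ _

lemma isRightCompatible_ofForm {g : Pivot k H} {l : H →ₗ[k] k}
    (hl : ∀ x y, l (x * y) = l (y * x)) (hr : IsSymmetrizedRightIntegral g l) :
    (ofForm l).IsRightCompatible g := by
  intro U V W a b
  refine ((ofForm_apply hl _ (U.frame.tensorRight g (Module.Basis.ofVectorSpace k V.obj)) _).trans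
    (Frame.trace_apply _ l _)).trans (Eq.trans ?_ (Frame.trace_apply _ l _).symm)
  rw [Fintype.sum_prod_type]
  refine Finset.sum_congr rfl fun i _ => ?_
  have h := congrArg (fun u => l (U.frame.coord i u)) (capRight_comp_cupRight_apply g (U := U.obj)
    (V := V.obj) (W := W.obj) a b (U.frame.vec i))
  simp only [map_sum] at h
  refine Eq.trans ?_ h.symm
  exact Finset.sum_congr rfl fun j _ => apply_tensorCoordRight hr _ _ _

lemma isLeftCompatible_ofForm {g : Pivot k H} {l : H →ₗ[k] k}
    (hl : ∀ x y, l (x * y) = l (y * x)) (hr : IsSymmetrizedLeftIntegral g l) :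
    (ofForm l).IsLeftCompatible g := by
  intro U V W a b
  refine ((ofForm_apply hl _ (V.frame.tensorLeft g (Module.Basis.ofVectorSpace k U.obj)) _).trans
    (Frame.trace_apply _ l _)).trans (Eq.trans ?_ (Frame.trace_apply _ l _).symm)
  rw [Fintype.sum_prod_type]
  refine Finset.sum_congr rfl fun i _ => ?_
  have h := congrArg (fun u => l (V.frame.coord i u)) (capLeft_comp_cupLeft_apply g (U := U.obj)
    (V := V.obj) (W := W.obj) a b (V.frame.vec i))
  simp only [map_sum] at h
  refine Eq.trans ?_ h.symm
  exact Finset.sum_congr rfl fun j _ => apply_tensorCoordLeft hr _ _ _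

end TraceFamily

end Trace

/-! ### Compatibility with duality and unibalanced Hopf algebras -/

section Unibalanced

open Coalgebra HopfAlgebra

variable {k H : Type u} [Field k] [Ring H] [HopfAlgebra k H]

lemma IsSymmetrizedRightIntegral.smul {g : Pivot k H} {l : H →ₗ[k] k}
    (hl : IsSymmetrizedRightIntegral g l) (a : k) : IsSymmetrizedRightIntegral g (a • l) :=
  fun x => by rw [contractFst_smul, hl, LinearMap.smul_apply, smul_assoc]

lemma IsSymmetrizedLeftIntegral.smul {g : Pivot k H} {l : H →ₗ[k] k}
    (hl : IsSymmetrizedLeftIntegral g l) (a : k) : IsSymmetrizedLeftIntegral g (a • l) :=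
  fun x => by rw [contractSnd_smul, hl, LinearMap.smul_apply, smul_assoc]

/-- The substitution `μ(x) = λ(g⁻¹ x)`, `ν(x) = λ(g x)` turns `μ(g x) = ν(g⁻¹ x)` into the statement
that `λ` is symmetrised on both sides. -/
lemma isUnibalanced_iff (g : Pivot k H) :
    IsUnibalanced g ↔ ∀ l : H →ₗ[k] k, IsSymmetrizedRightIntegral g l →
      IsSymmetrizedLeftIntegral g l := by
  constructor
  · intro h l hl
    obtain ⟨ν, hν, hlν⟩ := h _ ((isRightIntegral_comp_mulLeft_inv_iff g l).2 hl)
    rw [← isLeftIntegral_comp_mulLeft_iff]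
    convert hν using 1
    ext x
    have := hlν (g.val * x)
    simpa using this
  · intro h μ hμ
    refine ⟨μ ∘ₗ LinearMap.mulLeft k (g.val : H) ∘ₗ LinearMap.mulLeft k (g.val : H),
      (isLeftIntegral_comp_mulLeft_iff g (μ ∘ₗ LinearMap.mulLeft k (g.val : H))).2 (h _ ?_),
      fun x => by simp⟩
    rw [← isRightIntegral_comp_mulLeft_inv_iff]
    convert hμ using 1
    ext x
    simp

end Unibalanced

namespace TraceFamily

open Coalgebra HopfAlgebra HopfRep

variable {k H : Type u} [Field k] [Ring H] [HopfAlgebra k H] [FiniteDimensional k H]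

/-- The values of a cyclic family on composites `H → H ⊗ H → H`. -/
lemma form_apply_of_cyclic {t : TraceFamily k H} (ht : t.IsCalabiYau)
    (a : HopfProj.Hom ((HopfProj.regular k H).tensor (HopfProj.regular k H))
      (HopfProj.regular k H)) (z : H ⊗[k] H) :
    t.form (a.1 z) = t ((HopfProj.regular k H).tensor (HopfProj.regular k H))
      (Hom.comp (((HopfRep.regular k H).tensor (HopfRep.regular k H)).orbit z) a) := by
  refine Eq.trans ?_ (ht.cyclic (W := (HopfProj.regular k H).tensor (HopfProj.regular k H))
    (V := HopfProj.regular k H)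
    (((HopfRep.regular k H).tensor (HopfRep.regular k H)).orbit z) a)
  refine congrArg (t (HopfProj.regular k H)) (Subtype.ext (LinearMap.ext fun h => ?_))
  exact (a.2 h z).symm

lemma form_apply_one (t : TraceFamily k H) (f : Hom (HopfRep.regular k H) (HopfRep.regular k H)) :
    t (HopfProj.regular k H) f = t.form (f.1 (1 : H)) := by
  refine congrArg (t (HopfProj.regular k H)) (Subtype.ext (LinearMap.ext fun h => ?_))
  refine Eq.trans ?_ (f.2 h (1 : H))
  exact congrArg f.1 (mul_one h).symm

lemma isSymmetrizedRightIntegral_form {g : Pivot k H} {t : TraceFamily k H}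
    (ht : t.IsCalabiYau) (hr : t.IsRightCompatible g) : IsSymmetrizedRightIntegral g t.form := by
  intro h
  let R := HopfRep.regular k H
  let b := Module.Basis.ofVectorSpace k H
  apply g.antipode_injective
  refine (Module.forall_dual_apply_eq_zero_iff k _).1 (fun f => ?_) |> sub_eq_zero.1
  -- Compatibility is tested on the endomorphism of `H ⊗ H` that factors through `H` as the
  -- coordinate map attached to `f` followed by the orbit map of `h ⊗ 1`.
  let a : Hom (R.tensor R) R := ⟨tensorCoordRight (U := R) LinearMap.id R f,
    fun s x => tensorCoordRight_act g (U := R) (fun _ _ => rfl) R f s x⟩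
  have h₁ : t.form (a.1 (h ⊗ₜ 1)) = f (antipode k (contractFst t.form (comul (R := k) h))) := by
    change t.form (contractSnd (R.matrixCoeff f (1 : H) ∘ₗ antipode k) (comul (R := k) h)) = _
    rw [← apply_contractFst]
    exact congrArg f (mul_one _)
  have h₂ : ∀ v : H, a.1 ((1 : H) ⊗ₜ v) = f v • (1 : H) := by
    intro v
    change contractSnd (R.matrixCoeff f v ∘ₗ antipode k) (comul (R := k) 1) = _
    rw [Bialgebra.comul_one, Algebra.TensorProduct.one_def, contractSnd_tmul, LinearMap.comp_apply,
      antipode_one]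
    exact congrArg (fun y => f y • (1 : H)) (one_mul v)
  have h₃ : (Hom.comp (capRight g ((R.tensor R).orbit (h ⊗ₜ 1))) (cupRight a)).1 (1 : H) =
      f g.val • h := by
    refine (capRight_comp_cupRight_apply g a ((R.tensor R).orbit (h ⊗ₜ 1)) (1 : H)).trans ?_
    have h₄ : ∀ v : H, ((R.tensor R).orbit (h ⊗ₜ[k] (1 : H))).1 (a.1 ((1 : H) ⊗ₜ v)) =
        f v • (h ⊗ₜ[k] (1 : H)) := by
      intro v
      rw [h₂, map_smul, orbit_apply, map_one, Module.End.one_apply]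
    refine (Finset.sum_congr rfl fun j _ => ?_).trans
      (b.sum_coord_smul_apply (LinearMap.toSpanSingleton k H h ∘ₗ f) g.val)
    refine (congrArg (fun z => TensorProduct.rid k H
      ((b.coord j ∘ₗ R.ρ (g.val : H)).lTensor H z)) (h₄ (b j))).trans ?_
    have h₅ : R.ρ (g.val : H) (1 : H) = (g.val : H) := mul_one _
    rw [map_smul, map_smul, LinearMap.lTensor_tmul, TensorProduct.rid_tmul, LinearMap.comp_apply,
      h₅, smul_comm]
    rfl
  have h₆ := hr (HopfProj.regular k H) (HopfProj.regular k H) (HopfProj.regular k H) a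
    ((R.tensor R).orbit (h ⊗ₜ 1))
  have h₇ := (form_apply_of_cyclic ht a (h ⊗ₜ 1)).trans (h₆.trans (t.form_apply_one _))
  have h₈ := h₁.symm.trans (h₇.trans (congrArg t.form h₃))
  rw [map_sub, h₈, map_smul, map_smul, g.antipode_inv, map_smul, smul_eq_mul, smul_eq_mul,
    mul_comm, sub_self]

lemma isSymmetrizedLeftIntegral_form {g : Pivot k H} {t : TraceFamily k H}
    (ht : t.IsCalabiYau) (hr : t.IsLeftCompatible g) : IsSymmetrizedLeftIntegral g t.form := by
  intro h
  let R := HopfRep.regular k H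
  let b := Module.Basis.ofVectorSpace k H
  refine Function.LeftInverse.injective g.antipode_antipodeInv ?_
  refine (Module.forall_dual_apply_eq_zero_iff k _).1 (fun f => ?_) |> sub_eq_zero.1
  -- The test endomorphism is the coordinate map attached to `f` followed by the orbit map of `1 ⊗ h`.
  let a : Hom (R.tensor R) R := ⟨tensorCoordLeft g R (V := R) LinearMap.id f,
    fun s x => tensorCoordLeft_act g R (V := R) (fun _ _ => rfl) f s x⟩
  have hg₁ : g.antipodeInv 1 = 1 := by
    rw [← antipode_one (R := k) (A := H), g.antipodeInv_antipode, antipode_one]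
  have hg₂ : g.antipodeInv (g.val : H) = ((g.val⁻¹ : Hˣ) : H) := by
    rw [← g.antipode_inv, g.antipodeInv_antipode]
  have h₁ : t.form (a.1 (1 ⊗ₜ h)) = f (g.antipodeInv (contractSnd t.form (comul (R := k) h))) := by
    change t.form (contractFst (R.matrixCoeff f (1 : H) ∘ₗ g.antipodeInv) (comul (R := k) h)) = _
    rw [apply_contractFst]
    exact congrArg f (mul_one _)
  have h₂ : ∀ v : H, a.1 (v ⊗ₜ (1 : H)) = f v • (1 : H) := by
    intro v
    change contractFst (R.matrixCoeff f v ∘ₗ g.antipodeInv) (comul (R := k) 1) = _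
    rw [Bialgebra.comul_one, Algebra.TensorProduct.one_def, contractFst_tmul, LinearMap.comp_apply,
      hg₁]
    exact congrArg (fun y => f y • (1 : H)) (one_mul v)
  have h₃ : (Hom.comp (capLeft ((R.tensor R).orbit (1 ⊗ₜ h))) (cupLeft g a)).1 (1 : H) =
      f ((g.val⁻¹ : Hˣ) : H) • h := by
    refine (capLeft_comp_cupLeft_apply g a ((R.tensor R).orbit (1 ⊗ₜ h)) (1 : H)).trans ?_
    have h₄ : ∀ v : H, ((R.tensor R).orbit ((1 : H) ⊗ₜ[k] h)).1 (a.1 (v ⊗ₜ (1 : H))) =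
        f v • ((1 : H) ⊗ₜ[k] h) := by
      intro v
      rw [h₂, map_smul, orbit_apply, map_one, Module.End.one_apply]
    refine (Finset.sum_congr rfl fun j _ => ?_).trans
      (b.sum_coord_smul_apply (LinearMap.toSpanSingleton k H h ∘ₗ f) ((g.val⁻¹ : Hˣ) : H))
    refine (congrArg (fun z => TensorProduct.lid k H
      ((b.coord j ∘ₗ R.ρ ((g.val⁻¹ : Hˣ) : H)).rTensor H z)) (h₄ (b j))).trans ?_
    have h₅ : R.ρ ((g.val⁻¹ : Hˣ) : H) (1 : H) = ((g.val⁻¹ : Hˣ) : H) := mul_one _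
    rw [map_smul, map_smul, LinearMap.rTensor_tmul, TensorProduct.lid_tmul, LinearMap.comp_apply,
      h₅, smul_comm]
    rfl
  have h₆ := hr (HopfProj.regular k H) (HopfProj.regular k H) (HopfProj.regular k H) a
    ((R.tensor R).orbit (1 ⊗ₜ h))
  have h₇ := (form_apply_of_cyclic ht a (1 ⊗ₜ h)).trans (h₆.trans (t.form_apply_one _))
  have h₈ := h₁.symm.trans (h₇.trans (congrArg t.form h₃))
  rw [map_sub, h₈, map_smul, map_smul, hg₂, map_smul, smul_eq_mul, smul_eq_mul,
    mul_comm, sub_self]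

lemma isRightCompatible_iff {g : Pivot k H} {t : TraceFamily k H} (ht : t.IsCalabiYau) :
    t.IsRightCompatible g ↔ IsSymmetrizedRightIntegral g t.form := by
  refine ⟨isSymmetrizedRightIntegral_form ht, fun h => ?_⟩
  have := isRightCompatible_ofForm (form_symm ht) h
  rwa [ofForm_form ht] at this

lemma isLeftCompatible_iff {g : Pivot k H} {t : TraceFamily k H} (ht : t.IsCalabiYau) :
    t.IsLeftCompatible g ↔ IsSymmetrizedLeftIntegral g t.form := by
  refine ⟨isSymmetrizedLeftIntegral_form ht, fun h => ?_⟩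
  have := isLeftCompatible_ofForm (form_symm ht) h
  rwa [ofForm_form ht] at this

lemma IsCalabiYau.ne_zero {t : TraceFamily k H} (ht : t.IsCalabiYau) : t ≠ 0 := by
  rintro rfl
  have h := ht.nondegenerate_left (Hom.id (HopfProj.regular k H).obj) fun _ => rfl
  have h₁ : (1 : H) = 0 := LinearMap.congr_fun (congrArg Subtype.val h) (1 : H)
  have h₂ := congrArg (counit (R := k)) h₁
  rw [Bialgebra.counit_one, map_zero] at h₂
  exact one_ne_zero h₂

lemma IsCalabiYau.form_ne_zero {t : TraceFamily k H} (ht : t.IsCalabiYau) : t.form ≠ 0 := by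
  intro h
  have h₁ := ofForm_smul (0 : k) t.form
  rw [zero_smul, zero_smul, ← h, ofForm_form ht] at h₁
  exact ht.ne_zero h₁

/-- If the linear forms with property `D` are the multiples of one symmetric non-degenerate form,
then the Calabi–Yau structures whose form has property `D` are the non-zero elements of a line. -/
lemma exists_line {C : TraceFamily k H → Prop} {D : (H →ₗ[k] k) → Prop}
    (hCD : ∀ t : TraceFamily k H, t.IsCalabiYau → (C t ↔ D t.form)) {l : H →ₗ[k] k}
    (hD : ∀ l', D l' ↔ ∃ a : k, l' = a • l) (hs : ∀ x y, l (x * y) = l (y * x))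
    (hn : ∀ x, (∀ y, l (x * y) = 0) → x = 0) :
    ∃ L : Submodule k (TraceFamily k H), Module.finrank k L = 1 ∧
      ∀ t : TraceFamily k H, (t.IsCalabiYau ∧ C t) ↔ (t ∈ L ∧ t ≠ 0) := by
  refine ⟨k ∙ ofForm l, finrank_span_singleton (isCalabiYau_ofForm hs hn).ne_zero, fun t => ?_⟩
  rw [Submodule.mem_span_singleton]
  constructor
  · rintro ⟨ht, hC⟩
    obtain ⟨a, ha⟩ := (hD _).1 ((hCD t ht).1 hC)
    exact ⟨⟨a, by rw [← ofForm_smul, ← ha, ofForm_form ht]⟩, ht.ne_zero⟩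
  · rintro ⟨⟨a, rfl⟩, h⟩
    have ha : a ≠ 0 := by
      rintro rfl
      exact h (zero_smul _ _)
    rw [← ofForm_smul]
    have hs' : ∀ x y, (a • l) (x * y) = (a • l) (y * x) := fun x y => by simp [hs x y]
    have ht : (ofForm (a • l)).IsCalabiYau :=
      isCalabiYau_ofForm hs' fun x hx => hn x fun y => by simpa [ha] using hx y
    refine ⟨ht, (hCD _ ht).2 ?_⟩
    rw [form_ofForm hs']
    exact (hD _).2 ⟨a, rfl⟩

end TraceFamily

theorem corollary1p1 {k H : Type u} [Field k] [Ring H] [HopfAlgebra k H] [FiniteDimensional k H]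
    (hH : IsUnimodular k H) (g : Pivot k H) :
    (∃ L : Submodule k (TraceFamily k H), Module.finrank k L = 1 ∧
      ∀ t : TraceFamily k H, (t.IsCalabiYau ∧ t.IsRightCompatible g) ↔ (t ∈ L ∧ t ≠ 0)) ∧
    (∃ L : Submodule k (TraceFamily k H), Module.finrank k L = 1 ∧
      ∀ t : TraceFamily k H, (t.IsCalabiYau ∧ t.IsLeftCompatible g) ↔ (t ∈ L ∧ t ≠ 0)) ∧
    (∀ t : TraceFamily k H, t.IsCalabiYau → t.IsRightCompatible g →
      (t.IsLeftCompatible g ↔ IsUnibalanced g)) ∧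
    (∀ t : TraceFamily k H, t.IsCalabiYau → t.IsLeftCompatible g →
      (t.IsRightCompatible g ↔ IsUnibalanced g)) := by
  obtain ⟨r, hr, hr', hrs, hrn⟩ := hH.exists_symmetrizedRightIntegral g
  obtain ⟨l, hl, hl', hls, hln⟩ := hH.exists_symmetrizedLeftIntegral g
  have hR : ∀ s, IsSymmetrizedRightIntegral g s ↔ ∃ a : k, s = a • r :=
    fun s => ⟨hr' s, fun ⟨a, ha⟩ => ha ▸ hr.smul a⟩
  have hL : ∀ s, IsSymmetrizedLeftIntegral g s ↔ ∃ a : k, s = a • l :=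
    fun s => ⟨hl' s, fun ⟨a, ha⟩ => ha ▸ hl.smul a⟩
  -- A non-zero form that is both a right and a left symmetrised integral spans both lines.
  have hRL : ∀ s, s ≠ 0 → IsSymmetrizedRightIntegral g s → IsSymmetrizedLeftIntegral g s →
      IsUnibalanced g := by
    intro s hs h₁ h₂
    rw [isUnibalanced_iff]
    intro s' hs'
    obtain ⟨a, ha⟩ := hr' s h₁
    obtain ⟨a', ha'⟩ := hr' s' hs'
    have ha₀ : a ≠ 0 := by
      rintro rfl
      exact hs (by rw [ha, zero_smul])
    have h : s' = (a' * a⁻¹) • s := by rw [ha, ha', smul_smul, inv_mul_cancel_right₀ ha₀]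
    exact h ▸ h₂.smul _
  refine ⟨TraceFamily.exists_line (fun t ht => TraceFamily.isRightCompatible_iff ht) hR hrs hrn,
    TraceFamily.exists_line (fun t ht => TraceFamily.isLeftCompatible_iff ht) hL hls hln,
    fun t ht h => ?_, fun t ht h => ?_⟩
  · rw [TraceFamily.isRightCompatible_iff ht] at h
    rw [TraceFamily.isLeftCompatible_iff ht]
    exact ⟨hRL _ ht.form_ne_zero h, fun hu => (isUnibalanced_iff g).1 hu _ h⟩
  · rw [TraceFamily.isLeftCompatible_iff ht] at h
    rw [TraceFamily.isRightCompatible_iff ht]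
    refine ⟨fun h' => hRL _ ht.form_ne_zero h' h, fun hu => ?_⟩
    obtain ⟨a, ha⟩ := hl' _ ((isUnibalanced_iff g).1 hu r hr)
    obtain ⟨c, hc⟩ := hl' _ h
    have ha₀ : a ≠ 0 := by
      rintro rfl
      refine (TraceFamily.isCalabiYau_ofForm hrs hrn).form_ne_zero ?_
      rw [TraceFamily.form_ofForm hrs, ha, zero_smul]
    have h' : t.form = (c * a⁻¹) • r := by rw [ha, hc, smul_smul, inv_mul_cancel_right₀ ha₀]
    exact h' ▸ hr.smul _
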